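/- Let $K$ be an algebraically closed field, let $A$ be a finite-dimensional $K$-algebra, and let $\mathrm{mod}(A)$ be the category of finitely generated left $A$-modules. All subcategories of $\mathrm{mod}(A)$ are nonempty, full and closed under isomorphisms. A subcategory $\mathcal{C}$ is functorially finite if for every $X\in\mathrm{mod}(A)$ there are $C_1,C_2\in\mathcal{C}$ and morphisms $g_1\colon X\to C_1$, $g_2\colon C_2\to X$ such that for every $D\in\mathcal{C}$ the maps $\mathrm{Hom}_A(g_1,D)\colon \mathrm{Hom}_A(C_1,D)\to\mathrm{Hom}_A(X,D)$ and $\mathrm{Hom}_A(D,g_2)\colon \mathrm{Hom}_A(D,C_2)\to\mathrm{Hom}_A(D,X)$ are surjective. A torsion class is a subcategory closed under quotients and extensions. A wide subcategory is a subcategory that is closed under extensions and exact abelian (that is, it is an abelian category and its inclusion into $\mathrm{mod}(A)$ is exact). For a subcategory $\mathcal{C}$, let $\mathrm{gen}(\mathcal{C})$ be the subcategory of all quotients of finite direct sums of objects of $\mathcal{C}$, and let $\mathrm{filt}(\mathcal{C})$ be the subcategory of all $X\in\mathrm{mod}(A)$ that have a finite filtration $0=F_0\subseteq F_1\subseteq\dots\subseteq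 F_n=X$ by submodules with $F_i/F_{i-1}\in\mathcal{C}$ for $1\le i\le n$. For a wide subcategory $\mathcal{W}$ put $\mathcal{T}_{\mathcal{W}}=\mathrm{filt}(\mathrm{gen}(\mathcal{W}))$. For a torsion class $\mathcal{T}$ put $$\alpha(\mathcal{T})=\{X\in\mathcal{T}\mid \ker(g)\in\mathcal{T}\text{ for every morphism } g\colon Y\to X \text{ with } Y\in\mathcal{T}\}.$$ Then $\mathcal{T}\mapsto\alpha(\mathcal{T})$ is a bijection from the set of functorially finite torsion classes in $\mathrm{mod}(A)$ to the set of functorially finite wide subcategories $\mathcal{W}$ of $\mathrm{mod}(A)$ for which $\mathcal{T}_{\mathcal{W}}$ is functorially finite. -/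

import Mathlib

open CategoryTheory

universe u v

namespace ModSubcat

variable {A : Type u} [Ring A]

/-- The `A`-module `M` lies in the subcategory `C` of `mod A`, i.e. it is isomorphic to an
object of `C`. For a replete `C` and an object `M` of `mod A` this just says `C M`; the definition
makes sense also for modules, such as kernels, that are not given as bundled objects of `mod A`. -/
def Mem (C : ObjectProperty (FGModuleCat.{u} A)) (M : Type u) [AddCommGroup M] [Module A M] :
    Prop :=
  ∃ N : FGModuleCat.{u} A, C N ∧ Nonempty (N ≃ₗ[A] M)

/-- Every module in `mod A` admits a left and a right `C`-approximation. -/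
structure IsFunctoriallyFinite (C : ObjectProperty (FGModuleCat.{u} A)) : Prop where
  exists_left_approximation : ∀ X : FGModuleCat.{u} A,
    ∃ (C₁ : FGModuleCat.{u} A) (g₁ : X ⟶ C₁), C C₁ ∧
      ∀ D : FGModuleCat.{u} A, C D → Function.Surjective (fun h : C₁ ⟶ D => g₁ ≫ h)
  exists_right_approximation : ∀ X : FGModuleCat.{u} A,
    ∃ (C₂ : FGModuleCat.{u} A) (g₂ : C₂ ⟶ X), C C₂ ∧
      ∀ D : FGModuleCat.{u} A, C D → Function.Surjective (fun h : D ⟶ C₂ => h ≫ g₂)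

/-- Torsion classes: nonempty (equivalently, containing zero) and closed under quotients and
extensions in `mod A`. -/
structure IsTorsionClass (T : ObjectProperty (FGModuleCat.{u} A)) : Prop where
  containsZero : T.ContainsZero
  closedUnderQuotients : T.IsClosedUnderQuotients
  closedUnderExtensions : T.IsClosedUnderExtensions

/-- Exact abelian subcategories: the full subcategory is an abelian category and the inclusion
into `mod A` is an exact functor. -/
structure IsExactAbelian (W : ObjectProperty (FGModuleCat.{u} A)) : Prop where
  abelian : Nonempty (Abelian W.FullSubcategory)
  preservesFiniteLimits : Limits.PreservesFiniteLimits W.ι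
  preservesFiniteColimits : Limits.PreservesFiniteColimits W.ι

/-- Wide subcategories: replete, exact abelian, and closed under extensions in `mod A`. -/
structure IsWide (W : ObjectProperty (FGModuleCat.{u} A)) : Prop where
  replete : W.IsClosedUnderIsomorphisms
  exactAbelian : IsExactAbelian W
  closedUnderExtensions : W.IsClosedUnderExtensions

/-- `gen C`: all quotients of finite direct sums of objects of `C`. -/
def gen (C : ObjectProperty (FGModuleCat.{u} A)) : ObjectProperty (FGModuleCat.{u} A) :=
  fun X => ∃ (n : ℕ) (M : Fin n → FGModuleCat.{u} A) (f : (∀ i, M i) →ₗ[A] X),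
    (∀ i, C (M i)) ∧ Function.Surjective f

/-- `filt C`: all modules `X` with a finite filtration `0 = F₀ ⊆ F₁ ⊆ ⋯ ⊆ Fₙ = X` by submodules
all of whose subquotients `Fᵢ₊₁ / Fᵢ` lie in `C`. -/
def filt (C : ObjectProperty (FGModuleCat.{u} A)) : ObjectProperty (FGModuleCat.{u} A) :=
  fun X => ∃ (n : ℕ) (F : Fin (n + 1) → Submodule A X),
    Monotone F ∧ F 0 = ⊥ ∧ F (Fin.last n) = ⊤ ∧
      ∀ i : Fin n, Mem C (F i.succ ⧸ (F i.castSucc).submoduleOf (F i.succ))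

/-- `α T`: the objects `X` of `T` such that the kernel of every morphism `Y ⟶ X` with `Y` in `T`
lies in `T`. -/
def alpha (T : ObjectProperty (FGModuleCat.{u} A)) : ObjectProperty (FGModuleCat.{u} A) :=
  fun X => T X ∧ ∀ Y : FGModuleCat.{u} A, T Y → ∀ g : Y →ₗ[A] X, Mem T (LinearMap.ker g)

end ModSubcat

/-! The inverse map is $\mathcal{W}\mapsto\mathcal{T}_{\mathcal{W}}$. For every torsion class `T`
the subcategory `alpha T` is wide (`isWideMem_alpha`), and for every wide `W` one has `alpha (filt
(gen W)) = W` (`alpha_filt_gen`). The second fact rests on `range_and_ker_of_filt_gen`: a map from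
an object of `filt (gen W)` to an object of `W` has its image in `W` and its kernel in `filt (gen
W)`.

The equality `filt (gen (alpha T)) = T` uses functorial finiteness: a left `T`-approximation `L` of
`A` generates `T`. If the equality failed, Zorn's lemma would give a torsion class `V` containing
`filt (gen (alpha T))` and maximal among those inside `T` that miss `L`; no torsion class lies
strictly between `V` and `T`. A nonzero `V`-torsion-free object of `T` of minimal length then lies
in `alpha T` (`mem_alpha`), hence in `V`, which is absurd.

It remains to see that `alpha T` is functorially finite. Left approximations are the largest
quotients in `alpha T` of left `T`-approximations. That of `A` shrinks to a reflection `R`, which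
acts as a progenerator of `alpha T`. Since $\mathrm{Hom}_A(R,X)$ is finite-dimensional, all maps
from `R` to `X` factor through one map `R ^ n → X`, and a quotient of `R ^ n` approximates `X` from
the right. -/

namespace ModSubcat

variable {A : Type u} [Ring A]

/-! ### Membership of unbundled modules in subcategories of mod A -/

section Mem

variable {C D : ObjectProperty (FGModuleCat.{u} A)}
  {M N : Type u} [AddCommGroup M] [Module A M] [AddCommGroup N] [Module A N]

lemma Mem.of_equiv (h : Mem C M) (e : M ≃ₗ[A] N) : Mem C N := by
  obtain ⟨X, hX, ⟨f⟩⟩ := h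
  exact ⟨X, hX, ⟨f.trans e⟩⟩

lemma Mem.finite (h : Mem C M) : Module.Finite A M := by
  obtain ⟨X, -, ⟨f⟩⟩ := h
  exact Module.Finite.equiv f

lemma Mem.mono (h : Mem C M) (hCD : C ≤ D) : Mem D M := by
  obtain ⟨X, hX, f⟩ := h
  exact ⟨X, hCD _ hX, f⟩

lemma mem_of_prop {X : FGModuleCat.{u} A} (h : C X) : Mem C X :=
  ⟨X, h, ⟨LinearEquiv.refl A X⟩⟩

/-- A linear map between the modules underlying objects of `mod A`, as a morphism. -/
abbrev toHom {X Y : FGModuleCat.{u} A} (f : X →ₗ[A] Y) : X ⟶ Y :=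
  ObjectProperty.homMk (ModuleCat.ofHom f)

/-- A linear equivalence between objects of `mod A`, as an isomorphism. -/
def toIso {X Y : FGModuleCat.{u} A} (e : X ≃ₗ[A] Y) : X ≅ Y where
  hom := toHom e.toLinearMap
  inv := toHom e.symm.toLinearMap
  hom_inv_id := by ext x; exact e.left_inv x
  inv_hom_id := by ext x; exact e.right_inv x

lemma mem_iff [C.IsClosedUnderIsomorphisms] {X : FGModuleCat.{u} A} : Mem C X ↔ C X :=
  ⟨fun ⟨_, hY, ⟨e⟩⟩ => C.prop_of_iso (toIso e) hY, mem_of_prop⟩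

lemma eq_of_mem_iff [C.IsClosedUnderIsomorphisms] [D.IsClosedUnderIsomorphisms]
    (h : ∀ (M : Type u) [AddCommGroup M] [Module A M], Mem C M ↔ Mem D M) : C = D := by
  ext X
  rw [← mem_iff (C := C), ← mem_iff (C := D), h]

lemma le_of_mem_imp [D.IsClosedUnderIsomorphisms]
    (h : ∀ (M : Type u) [AddCommGroup M] [Module A M], Mem C M → Mem D M) : C ≤ D :=
  fun X hX => (mem_iff (C := D)).1 (h X (mem_of_prop hX))

lemma isClosedUnderIsomorphisms_of
    (h : ∀ X Y : FGModuleCat.{u} A, C X → Nonempty (X ≃ₗ[A] Y) → C Y) :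
    C.IsClosedUnderIsomorphisms :=
  ⟨fun e hX => h _ _ hX ⟨FGModuleCat.isoToLinearEquiv e⟩⟩

end Mem

/-! ### Exactness, kernels and cokernels in mod A -/

section Categorical

variable [IsNoetherianRing A]

lemma epi_iff_surjective {X Y : FGModuleCat.{u} A} (f : X ⟶ Y) :
    Epi f ↔ Function.Surjective f.hom.hom := by
  constructor
  · intro h
    exact (ModuleCat.epi_iff_surjective _).1
      (inferInstanceAs (Epi ((forget₂ (FGModuleCat.{u} A) (ModuleCat.{u} A)).map f)))
  · intro h
    have : Epi ((forget₂ (FGModuleCat.{u} A) (ModuleCat.{u} A)).map f) :=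
      (ModuleCat.epi_iff_surjective _).2 h
    exact (forget₂ (FGModuleCat.{u} A) (ModuleCat.{u} A)).epi_of_epi_map this

lemma mono_iff_injective {X Y : FGModuleCat.{u} A} (f : X ⟶ Y) :
    Mono f ↔ Function.Injective f.hom.hom := by
  constructor
  · intro h
    exact (ModuleCat.mono_iff_injective _).1
      (inferInstanceAs (Mono ((forget₂ (FGModuleCat.{u} A) (ModuleCat.{u} A)).map f)))
  · intro h
    have : Mono ((forget₂ (FGModuleCat.{u} A) (ModuleCat.{u} A)).map f) :=
      (ModuleCat.mono_iff_injective _).2 h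
    exact (forget₂ (FGModuleCat.{u} A) (ModuleCat.{u} A)).mono_of_mono_map this

lemma shortExact_iff (S : ShortComplex (FGModuleCat.{u} A)) :
    S.ShortExact ↔ Function.Injective S.f.hom.hom ∧ Function.Surjective S.g.hom.hom ∧
      LinearMap.range S.f.hom.hom = LinearMap.ker S.g.hom.hom := by
  have key : S.Exact ↔ LinearMap.range S.f.hom.hom = LinearMap.ker S.g.hom.hom := by
    rw [← ShortComplex.exact_map_iff_of_faithful S (forget₂ (FGModuleCat.{u} A) (ModuleCat.{u} A)),
      ShortComplex.moduleCat_exact_iff_range_eq_ker]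
    rfl
  constructor
  · intro h
    exact ⟨(mono_iff_injective _).1 h.mono_f, (epi_iff_surjective _).1 h.epi_g, key.1 h.exact⟩
  · rintro ⟨h1, h2, h3⟩
    exact { exact := key.2 h3, mono_f := (mono_iff_injective _).2 h1,
            epi_g := (epi_iff_surjective _).2 h2 }

/-- The submodule `ker f` is a categorical kernel of `f` in `mod A`. -/
def kernelForkIsLimit {X Y : FGModuleCat.{u} A} (f : X ⟶ Y) :
    Limits.IsLimit (Limits.KernelFork.ofι (f := f)
      (toHom (X := FGModuleCat.of A (LinearMap.ker f.hom.hom)) (LinearMap.ker f.hom.hom).subtype)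
      (by ext x; exact x.2)) :=
  Limits.KernelFork.IsLimit.ofι _ _
    (fun {Z} g hg => toHom (Y := FGModuleCat.of A (LinearMap.ker f.hom.hom))
      (LinearMap.codRestrict (LinearMap.ker f.hom.hom) g.hom.hom
      (fun c => congr($(hg).hom.hom c))))
    (fun g hg => by ext x; rfl)
    (fun g hg m hm => by
      ext x
      exact congr($(hm).hom.hom x))

/-- The quotient by `range f` is a categorical cokernel of `f` in `mod A`. -/
def cokernelCoforkIsColimit {X Y : FGModuleCat.{u} A} (f : X ⟶ Y) :
    Limits.IsColimit (Limits.CokernelCofork.ofπ (f := f)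
      (toHom (Y := FGModuleCat.of A (Y ⧸ LinearMap.range f.hom.hom))
        (LinearMap.range f.hom.hom).mkQ)
      (by ext x; exact (Submodule.Quotient.mk_eq_zero _).2 ⟨x, rfl⟩)) :=
  Limits.CokernelCofork.IsColimit.ofπ _ _
    (fun {Z} g hg => toHom (X := FGModuleCat.of A (Y ⧸ LinearMap.range f.hom.hom))
      (Submodule.liftQ _ g.hom.hom (by
        rintro _ ⟨c, rfl⟩
        exact congr($(hg).hom.hom c))))
    (fun g hg => by ext x; rfl)
    (fun g hg m hm => by
      ext x
      exact congr($(hm).hom.hom x))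

end Categorical

end ModSubcat

namespace ModSubcat

variable {A : Type u} [Ring A]

/-! ### Categorical closure properties in terms of modules -/

section Translation

variable {C : ObjectProperty (FGModuleCat.{u} A)}

lemma containsZero_iff [C.IsClosedUnderIsomorphisms] :
    C.ContainsZero ↔ Mem C (PUnit.{u + 1}) := by
  have h0 : Limits.IsZero (FGModuleCat.of A PUnit.{u + 1}) := by
    refine (Limits.IsZero.iff_id_eq_zero _).2 ?_
    ext x
  constructor
  · intro h
    exact mem_of_prop (C.prop_of_isZero h0)
  · intro h
    exact ⟨_, h0, (mem_iff (X := FGModuleCat.of A PUnit.{u + 1})).1 h⟩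

lemma isClosedUnderCokernels_iff [C.IsClosedUnderIsomorphisms] :
    C.IsClosedUnderCokernels ↔
      ∀ (M N : Type u) [AddCommGroup M] [Module A M] [AddCommGroup N] [Module A N]
        (f : M →ₗ[A] N), Mem C M → Mem C N → Mem C (N ⧸ LinearMap.range f) := by
  constructor
  · intro h M N _ _ _ _ f hM hN
    have := hM.finite
    have := hN.finite
    exact mem_of_prop (C.prop_of_isColimit_cokernelCofork
      (cokernelCoforkIsColimit (FGModuleCat.ofHom f)) (mem_iff.1 hM) (mem_iff.1 hN))
  · refine fun h => ⟨fun Z hZ => ?_⟩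
    obtain ⟨f, k, hk, hf⟩ := hZ
    refine C.prop_of_iso (Limits.IsColimit.coconePointUniqueUpToIso
      (cokernelCoforkIsColimit f) hk) ?_
    exact mem_iff.1 (h _ _ f.hom.hom (mem_of_prop hf.1) (mem_of_prop hf.2))

variable [IsNoetherianRing A]

lemma isClosedUnderExtensions_iff [C.IsClosedUnderIsomorphisms] :
    C.IsClosedUnderExtensions ↔
      ∀ (M : Type u) [AddCommGroup M] [Module A M] (N : Submodule A M),
        Mem C N → Mem C (M ⧸ N) → Mem C M := by
  constructor
  · intro h M _ _ N hN hQ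
    have := hN.finite
    have := hQ.finite
    have : Module.Finite A M := Module.Finite.of_submodule_quotient N
    let S : ShortComplex (FGModuleCat.{u} A) :=
      ShortComplex.mk (FGModuleCat.ofHom N.subtype) (FGModuleCat.ofHom N.mkQ)
        (by ext x; exact (Submodule.Quotient.mk_eq_zero _).2 x.2)
    have hS : S.ShortExact := by
      rw [shortExact_iff]
      exact ⟨N.subtype_injective, N.mkQ_surjective, by
        change LinearMap.range N.subtype = LinearMap.ker N.mkQ
        simp⟩
    exact mem_of_prop (C.prop_X₂_of_shortExact hS (mem_iff.1 hN) (mem_iff.1 hQ))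
  · intro h
    refine ⟨fun {S} hS h₁ h₃ => ?_⟩
    obtain ⟨hi, hs, he⟩ := (shortExact_iff S).1 hS
    refine mem_iff.1 (h S.X₂ (LinearMap.ker S.g.hom.hom) ?_ ?_)
    · rw [← he]
      exact (mem_of_prop h₁).of_equiv (LinearEquiv.ofInjective _ hi)
    · exact (mem_of_prop h₃).of_equiv (LinearMap.quotKerEquivOfSurjective _ hs).symm

lemma isClosedUnderQuotients_iff [C.IsClosedUnderIsomorphisms] :
    C.IsClosedUnderQuotients ↔
      ∀ (M N : Type u) [AddCommGroup M] [Module A M] [AddCommGroup N] [Module A N]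
        (f : M →ₗ[A] N), Function.Surjective f → Mem C M → Mem C N := by
  constructor
  · intro h M N _ _ _ _ f hf hM
    have := hM.finite
    have : Module.Finite A N := Module.Finite.of_surjective f hf
    have : Epi (FGModuleCat.ofHom f) := (epi_iff_surjective _).2 hf
    exact mem_of_prop (C.prop_of_epi (FGModuleCat.ofHom f) (mem_iff.1 hM))
  · intro h
    exact ⟨fun f _ hX => mem_iff.1 (h _ _ f.hom.hom ((epi_iff_surjective f).1 inferInstance)
      (mem_of_prop hX))⟩

lemma isClosedUnderKernels_iff [C.IsClosedUnderIsomorphisms] :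
    C.IsClosedUnderKernels ↔
      ∀ (M N : Type u) [AddCommGroup M] [Module A M] [AddCommGroup N] [Module A N]
        (f : M →ₗ[A] N), Mem C M → Mem C N → Mem C (LinearMap.ker f) := by
  constructor
  · intro h M N _ _ _ _ f hM hN
    have := hM.finite
    have := hN.finite
    exact mem_of_prop (C.prop_of_isLimit_kernelFork
      (kernelForkIsLimit (FGModuleCat.ofHom f)) (mem_iff.1 hM) (mem_iff.1 hN))
  · refine fun h => ⟨fun Z hZ => ?_⟩
    obtain ⟨f, k, hk, hf⟩ := hZ
    refine C.prop_of_iso (Limits.IsLimit.conePointUniqueUpToIso (kernelForkIsLimit f) hk) ?_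
    exact mem_iff.1 (h _ _ f.hom.hom (mem_of_prop hf.1) (mem_of_prop hf.2))

end Translation

/-- Module-theoretic form of the closure properties of wide subcategories. -/
structure IsWideMem (W : ObjectProperty (FGModuleCat.{u} A)) : Prop where
  replete : W.IsClosedUnderIsomorphisms
  zero : Mem W (PUnit.{u + 1})
  ker : ∀ (M N : Type u) [AddCommGroup M] [Module A M] [AddCommGroup N] [Module A N]
    (f : M →ₗ[A] N), Mem W M → Mem W N → Mem W (LinearMap.ker f)
  coker : ∀ (M N : Type u) [AddCommGroup M] [Module A M] [AddCommGroup N] [Module A N]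
    (f : M →ₗ[A] N), Mem W M → Mem W N → Mem W (N ⧸ LinearMap.range f)
  ext : ∀ (M : Type u) [AddCommGroup M] [Module A M] (N : Submodule A M),
    Mem W N → Mem W (M ⧸ N) → Mem W M

variable [IsNoetherianRing A]

/-- Limits and colimits exist in the abelian category `W` and are preserved by the inclusion, so by
repleteness those computed in mod A already lie in `W`. -/
theorem IsWide.isWideMem {W : ObjectProperty (FGModuleCat.{u} A)} (h : IsWide W) :
    IsWideMem W := by
  have := h.replete
  obtain ⟨hab⟩ := h.exactAbelian.abelian
  have := h.exactAbelian.preservesFiniteLimits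
  have := h.exactAbelian.preservesFiniteColimits
  have hl := W.isClosedUnderLimitsOfShape_of_preservesLimitsOfShape_ι
    Limits.WalkingParallelPair
  have hc := W.isClosedUnderColimitsOfShape_of_preservesColimitsOfShape_ι
    Limits.WalkingParallelPair
  -- The empty diagram provides the zero object, as a terminal object.
  have hz := W.isClosedUnderLimitsOfShape_of_preservesLimitsOfShape_ι
    (Discrete PEmpty.{1})
  refine ⟨h.replete, ?_, isClosedUnderKernels_iff.1 ⟨fun Z hZ => ?_⟩,
    isClosedUnderCokernels_iff.1 ⟨fun Z hZ => ?_⟩,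
    isClosedUnderExtensions_iff.1 h.closedUnderExtensions⟩
  · exact containsZero_iff.1 ⟨_, (Limits.isZero_zero _).of_iso
      (Limits.HasZeroObject.zeroIsoTerminal).symm, W.prop_terminal⟩
  · obtain ⟨f, k, hk, hf⟩ := hZ
    refine W.prop_of_isLimit hk ?_
    rintro (_ | _)
    exacts [hf.1, hf.2]
  · obtain ⟨f, k, hk, hf⟩ := hZ
    refine W.prop_of_isColimit hk ?_
    rintro (_ | _)
    exacts [hf.1, hf.2]

theorem IsWideMem.isWide {W : ObjectProperty (FGModuleCat.{u} A)} (h : IsWideMem W) :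
    IsWide W := by
  have := h.replete
  have := containsZero_iff.2 h.zero
  have := isClosedUnderKernels_iff.2 h.ker
  have := isClosedUnderCokernels_iff.2 h.coker
  have he := isClosedUnderExtensions_iff.2 h.ext
  -- A direct sum is an extension of its summands.
  have : W.IsClosedUnderBinaryProducts := by
    refine .mk' ?_
    rintro _ ⟨F, hF⟩
    refine W.prop_of_iso ?_ (W.prop_biprod (hF ⟨Limits.WalkingPair.left⟩)
      (hF ⟨Limits.WalkingPair.right⟩))
    exact Limits.biprod.isoProd _ _ ≪≫
      Limits.HasLimit.isoOfNatIso (Limits.diagramIsoPair F).symm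
  have : W.IsClosedUnderFiniteProducts := .mk'
  have : Limits.HasBinaryBiproducts W.FullSubcategory :=
    Limits.HasBinaryBiproducts.of_hasBinaryProducts
  have : W.ι.Additive := inferInstance
  have hk := W.preservesKernels_ι
  have hc := W.preservesCokernels_ι
  exact ⟨h.replete, ⟨⟨inferInstance⟩, W.ι.preservesFiniteLimits_of_preservesKernels,
    W.ι.preservesFiniteColimits_of_preservesCokernels⟩, he⟩

end ModSubcat

/-! ### Extension-closed subcategories, torsion classes, filtrations -/

namespace ModSubcat

variable {A : Type u} [Ring A]

/-- Subcategories of `mod A` that contain zero and are closed under isomorphisms and extensions,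
in module-theoretic form. -/
structure IsExtensionClosed (C : ObjectProperty (FGModuleCat.{u} A)) : Prop where
  zero : Mem C (PUnit.{u + 1})
  ext : ∀ (M : Type u) [AddCommGroup M] [Module A M] (N : Submodule A M),
    Mem C N → Mem C (M ⧸ N) → Mem C M

namespace IsExtensionClosed

variable {C : ObjectProperty (FGModuleCat.{u} A)} (hC : IsExtensionClosed C)
  {M N : Type u} [AddCommGroup M] [Module A M] [AddCommGroup N] [Module A N]

include hC

lemma of_subsingleton [Subsingleton M] : Mem C M :=
  hC.zero.of_equiv (0 : PUnit.{u + 1} ≃ₗ[A] M)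

lemma of_surjective (f : M →ₗ[A] N) (hf : Function.Surjective f)
    (hK : Mem C (LinearMap.ker f)) (hN : Mem C N) : Mem C M :=
  hC.ext M _ hK (hN.of_equiv (f.quotKerEquivOfSurjective hf).symm)

lemma of_exact {K : Type u} [AddCommGroup K] [Module A K] (i : K →ₗ[A] M) (p : M →ₗ[A] N)
    (hi : Function.Injective i) (hp : Function.Surjective p) (h : Function.Exact i p)
    (hK : Mem C K) (hN : Mem C N) : Mem C M := by
  refine hC.of_surjective p hp ?_ hN
  rw [h.linearMap_ker_eq]
  exact hK.of_equiv (LinearEquiv.ofInjective i hi)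

/-- Serves maximality arguments: if `P` is a maximal submodule with some property implying
membership in `C`, a nonzero submodule of the quotient by `P` that lies in `C` pulls back to a
larger candidate. -/
lemma comap_mkQ {P : Submodule A M} {Q : Submodule A (M ⧸ P)} (hP : Mem C P) (hQ : Mem C Q) :
    Mem C (Q.comap P.mkQ) := by
  have hle : P ≤ Q.comap P.mkQ := Submodule.le_comap_mkQ P Q
  refine hC.of_exact (Submodule.inclusion hle)
    (P.mkQ.restrict (p := Q.comap P.mkQ) (q := Q) fun x hx => hx)
    (Submodule.inclusion_injective hle) ?_ ?_ hP hQ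
  · rintro ⟨y, hy⟩
    obtain ⟨x, rfl⟩ := P.mkQ_surjective y
    exact ⟨⟨x, hy⟩, rfl⟩
  · intro x
    constructor
    · intro h
      exact ⟨⟨x, (Submodule.Quotient.mk_eq_zero P).1 (congr_arg Subtype.val h)⟩, rfl⟩
    · rintro ⟨z, rfl⟩
      exact Subtype.ext ((Submodule.Quotient.mk_eq_zero P).2 z.2)

lemma prod (hM : Mem C M) (hN : Mem C N) : Mem C (M × N) := by
  refine hC.of_surjective (LinearMap.snd A M N) LinearMap.snd_surjective ?_ hN
  rw [LinearMap.ker_snd]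
  exact hM.of_equiv (LinearEquiv.ofInjective _ LinearMap.inl_injective)

lemma pi {n : ℕ} (P : Fin n → Type u) [∀ i, AddCommGroup (P i)] [∀ i, Module A (P i)]
    (hP : ∀ i, Mem C (P i)) : Mem C (∀ i, P i) := by
  induction n with
  | zero => exact hC.of_subsingleton
  | succ n ih =>
    exact (hC.prod (hP 0) (ih (fun i => P i.succ) fun i => hP i.succ)).of_equiv
      (Fin.consLinearEquiv A P)

end IsExtensionClosed

section Submodule

variable {M N : Type u} [AddCommGroup M] [Module A M] [AddCommGroup N] [Module A N]

lemma eq_bot_of_comap_mkQ_le {P : Submodule A M} {Q : Submodule A (M ⧸ P)}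
    (h : Q.comap P.mkQ ≤ P) : Q = ⊥ := by
  rw [eq_bot_iff]
  intro y hy
  obtain ⟨x, rfl⟩ := P.mkQ_surjective y
  exact (Submodule.Quotient.mk_eq_zero P).2 (h hy)

lemma map_ne_bot {f : M →ₗ[A] N} (hf : Function.Injective f) {P : Submodule A M} (hP : P ≠ ⊥) :
    P.map f ≠ ⊥ := fun h =>
  hP (Submodule.map_injective_of_injective hf (h.trans (Submodule.map_bot f).symm))

end Submodule

section TorsionClass

lemma IsTorsionClass.replete {T : ObjectProperty (FGModuleCat.{u} A)}
    (hT : IsTorsionClass T) : T.IsClosedUnderIsomorphisms := by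
  have := hT.closedUnderQuotients
  infer_instance

variable [IsNoetherianRing A] {T : ObjectProperty (FGModuleCat.{u} A)}
  {M N : Type u} [AddCommGroup M] [Module A M] [AddCommGroup N] [Module A N]

lemma IsTorsionClass.isExtensionClosed (hT : IsTorsionClass T) : IsExtensionClosed T := by
  have := hT.replete
  exact ⟨containsZero_iff.1 hT.containsZero,
    isClosedUnderExtensions_iff.1 hT.closedUnderExtensions⟩

lemma IsTorsionClass.quotient (hT : IsTorsionClass T) (f : M →ₗ[A] N)
    (hf : Function.Surjective f) (hM : Mem T M) : Mem T N := by
  have := hT.replete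
  exact isClosedUnderQuotients_iff.1 hT.closedUnderQuotients M N f hf hM

lemma isTorsionClass_of (hT : IsExtensionClosed T) (hr : T.IsClosedUnderIsomorphisms)
    (hq : ∀ (M N : Type u) [AddCommGroup M] [Module A M] [AddCommGroup N] [Module A N]
        (f : M →ₗ[A] N), Function.Surjective f → Mem T M → Mem T N) : IsTorsionClass T :=
  ⟨containsZero_iff.2 hT.zero, isClosedUnderQuotients_iff.2 hq, isClosedUnderExtensions_iff.2 hT.ext⟩

lemma IsTorsionClass.range (hT : IsTorsionClass T) (f : M →ₗ[A] N) (hM : Mem T M) :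
    Mem T (LinearMap.range f) :=
  hT.quotient f.rangeRestrict f.surjective_rangeRestrict hM

lemma IsTorsionClass.sup (hT : IsTorsionClass T) {P Q : Submodule A M}
    (hP : Mem T P) (hQ : Mem T Q) : Mem T ↥(P ⊔ Q) := by
  have h := hT.range (P.subtype.coprod Q.subtype) (hT.isExtensionClosed.prod hP hQ)
  rwa [LinearMap.range_coprod, Submodule.range_subtype, Submodule.range_subtype] at h

/-- Every finitely generated module has a largest submodule in a given torsion class, and the
quotient by it has no nonzero submodules in the torsion class. -/
lemma IsTorsionClass.exists_torsion (hT : IsTorsionClass T) [Module.Finite A M] :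
    ∃ t : Submodule A M, Mem T t ∧ (∀ P : Submodule A M, Mem T P → P ≤ t) ∧
      ∀ P : Submodule A (M ⧸ t), Mem T P → P = ⊥ := by
  obtain ⟨t, ht, hmax⟩ := set_has_maximal_iff_noetherian.2
    (inferInstance : IsNoetherian A M) {P : Submodule A M | Mem T P}
    ⟨⊥, hT.isExtensionClosed.of_subsingleton⟩
  have hle : ∀ P : Submodule A M, Mem T P → P ≤ t := by
    intro P hP
    have h := hmax _ (hT.sup ht hP)
    have : t = t ⊔ P := le_sup_left.eq_of_not_lt h
    rw [this]
    exact le_sup_right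
  refine ⟨t, ht, hle, fun P hP => ?_⟩
  have h := hle _ (hT.isExtensionClosed.comap_mkQ ht hP)
  exact eq_bot_of_comap_mkQ_le h

end TorsionClass

section Filt

variable {C : ObjectProperty (FGModuleCat.{u} A)}
  {M N : Type u} [AddCommGroup M] [Module A M] [AddCommGroup N] [Module A N]

/-- `M` has a finite filtration with subquotients in `C`. -/
def HasFiltration (C : ObjectProperty (FGModuleCat.{u} A)) (M : Type u) [AddCommGroup M]
    [Module A M] : Prop :=
  ∃ (n : ℕ) (F : Fin (n + 1) → Submodule A M),
    Monotone F ∧ F 0 = ⊥ ∧ F (Fin.last n) = ⊤ ∧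
      ∀ i : Fin n, Mem C (F i.succ ⧸ (F i.castSucc).submoduleOf (F i.succ))

/-- An injective linear map identifies subquotients with their images. -/
noncomputable def subquotientMapEquiv (j : M →ₗ[A] N) (hj : Function.Injective j)
    (P Q : Submodule A M) :
    (Q ⧸ P.submoduleOf Q) ≃ₗ[A] (Q.map j ⧸ (P.map j).submoduleOf (Q.map j)) :=
  Submodule.Quotient.equiv _ _ (Submodule.equivMapOfInjective j hj Q) (by
    ext ⟨y, hy⟩
    obtain ⟨x, hx, rfl⟩ := hy
    simp only [Submodule.mem_map, Submodule.submoduleOf, Submodule.mem_comap]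
    constructor
    · rintro ⟨z, hz, hzx⟩
      exact ⟨z, hz, congr_arg Subtype.val hzx⟩
    · rintro ⟨z, hz, hzx⟩
      obtain rfl : z = x := hj hzx
      exact ⟨⟨z, hx⟩, hz, rfl⟩)

lemma HasFiltration.of_equiv (h : HasFiltration C M) (e : M ≃ₗ[A] N) : HasFiltration C N := by
  obtain ⟨n, F, hF, h0, h1, hs⟩ := h
  refine ⟨n, fun i => (F i).map e.toLinearMap, fun i j hij => Submodule.map_mono (hF hij),
    by simp [h0], by simp [h1], fun i => ?_⟩
  exact (hs i).of_equiv (subquotientMapEquiv _ e.injective _ _)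

lemma HasFiltration.of_submodule (P : Submodule A M) (h : HasFiltration C P)
    (hQ : Mem C (M ⧸ P)) : HasFiltration C M := by
  obtain ⟨n, F, hF, h0, h1, hs⟩ := h
  let G : Fin (n + 2) → Submodule A M :=
    Fin.snoc (α := fun _ => Submodule A M) (fun i => (F i).map P.subtype) ⊤
  have hG : ∀ i, G (Fin.castSucc i) = (F i).map P.subtype := fun i =>
    Fin.snoc_castSucc (α := fun _ => Submodule A M) _ _ i
  have hGl : G (Fin.last _) = ⊤ := Fin.snoc_last (α := fun _ => Submodule A M) _ _
  refine ⟨n + 1, G, Fin.monotone_iff_le_succ.2 fun i => ?_, ?_, hGl, fun i => ?_⟩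
  · induction i using Fin.lastCases with
    | last => rw [Fin.succ_last, hGl]; exact le_top
    | cast i =>
      rw [Fin.succ_castSucc, hG, hG]
      exact Submodule.map_mono (hF (Fin.castSucc_le_succ i))
  · rw [← Fin.castSucc_zero, hG, h0, Submodule.map_bot]
  · induction i using Fin.lastCases with
    | last =>
      rw [Fin.succ_last, hGl, hG, h1, Submodule.map_top, Submodule.range_subtype]
      refine hQ.of_equiv (Submodule.Quotient.equiv _ _ (Submodule.topEquiv (R := A)).symm ?_)
      ext x
      simp [Submodule.submoduleOf]
    | cast i =>
      rw [Fin.succ_castSucc, hG, hG]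
      exact (hs i).of_equiv (subquotientMapEquiv _ P.subtype_injective _ _)

lemma filt_replete : (filt C).IsClosedUnderIsomorphisms :=
  isClosedUnderIsomorphisms_of fun _ _ hX ⟨e⟩ => HasFiltration.of_equiv (C := C) hX e

lemma mem_filt_iff : Mem (filt C) M ↔ Module.Finite A M ∧ HasFiltration C M := by
  constructor
  · intro h
    refine ⟨h.finite, ?_⟩
    obtain ⟨X, hX, ⟨e⟩⟩ := h
    exact HasFiltration.of_equiv (C := C) hX e
  · rintro ⟨h, hF⟩
    exact mem_of_prop (X := FGModuleCat.of A M) hF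

lemma mem_filt_of_subsingleton [Subsingleton M] : Mem (filt C) M :=
  mem_filt_iff.2 ⟨inferInstance, 0, fun _ => ⊥, monotone_const, rfl, Subsingleton.elim _ _,
    fun i => i.elim0⟩

lemma mem_filt_of_submodule (P : Submodule A M) (h : Mem (filt C) P) (hQ : Mem C (M ⧸ P)) :
    Mem (filt C) M := by
  have := h.finite
  have := hQ.finite
  exact mem_filt_iff.2 ⟨Module.Finite.of_submodule_quotient P,
    HasFiltration.of_submodule P (mem_filt_iff.1 h).2 hQ⟩

lemma Mem.filt (h : Mem C M) : Mem (filt C) M :=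
  mem_filt_of_submodule ⊥ mem_filt_of_subsingleton
    (h.of_equiv (Submodule.quotEquivOfEqBot (⊥ : Submodule A M) rfl).symm)

/-- Induction along the filtration. Invariance under isomorphism is required because each step is
seen both as a submodule of the whole module and as a submodule of the next step. -/
theorem Mem.filt_induction (Q : ∀ (M : Type u) [AddCommGroup M] [Module A M], Prop)
    (equiv : ∀ (M N : Type u) [AddCommGroup M] [Module A M] [AddCommGroup N] [Module A N],
      (M ≃ₗ[A] N) → Q M → Q N)
    (zero : ∀ (M : Type u) [AddCommGroup M] [Module A M], Subsingleton M → Q M)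
    (step : ∀ (M : Type u) [AddCommGroup M] [Module A M] (P : Submodule A M),
      Q P → Mem C (M ⧸ P) → Q M) (h : Mem (ModSubcat.filt C) M) : Q M := by
  obtain ⟨-, n, F, hF, h0, h1, hs⟩ := mem_filt_iff.1 h
  have key : ∀ i, Q (F i) := by
    intro i
    induction i using Fin.induction with
    | zero => rw [h0]; exact zero _ inferInstance
    | succ i ih =>
      exact step _ _ (equiv _ _
        (Submodule.submoduleOfEquivOfLe (hF (Fin.castSucc_le_succ i))).symm ih) (hs i)
  have := key (Fin.last n)
  rw [h1] at this
  exact equiv _ _ Submodule.topEquiv this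

lemma isExtensionClosed_filt : IsExtensionClosed (filt C) := by
  refine ⟨mem_filt_of_subsingleton, fun M _ _ N hN hQ => ?_⟩
  -- The filtration of the quotient is pulled back step by step, so the claim is generalized to all
  -- surjections onto `Z` with filtered kernel.
  have key := hQ.filt_induction
    (fun Z _ _ => ∀ (M : Type u) [AddCommGroup M] [Module A M] (f : M →ₗ[A] Z),
      Function.Surjective f → Mem (filt C) (LinearMap.ker f) → Mem (filt C) M) ?_ ?_ ?_
  · refine key M N.mkQ N.mkQ_surjective ?_
    rwa [Submodule.ker_mkQ]
  · intro Z Z' _ _ _ _ e h M _ _ f hf hK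
    refine h M (e.symm.toLinearMap ∘ₗ f) (e.symm.surjective.comp hf) ?_
    rwa [LinearEquiv.ker_comp]
  · intro Z _ _ _ M _ _ f _ hK
    have : LinearMap.ker f = ⊤ := by
      ext x
      simpa using Subsingleton.elim _ _
    rw [this] at hK
    exact hK.of_equiv Submodule.topEquiv
  · intro Z _ _ P h hP M _ _ f hf hK
    refine mem_filt_of_submodule (P.comap f) ?_ ?_
    · let g : P.comap f →ₗ[A] P := f.restrict fun x hx => hx
      refine h _ g ?_ ?_
      · rintro ⟨y, hy⟩
        obtain ⟨x, rfl⟩ := hf y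
        exact ⟨⟨x, hy⟩, rfl⟩
      · have hle : LinearMap.ker f ≤ P.comap f := fun x hx => by
          simp [LinearMap.mem_ker.1 hx]
        refine hK.of_equiv ((Submodule.submoduleOfEquivOfLe hle).symm.trans
          (LinearEquiv.ofEq _ _ ?_))
        ext x
        simp [g, Submodule.submoduleOf, Subtype.ext_iff]
    · have hs : Function.Surjective (P.mkQ ∘ₗ f) := P.mkQ_surjective.comp hf
      refine hP.of_equiv (((P.mkQ ∘ₗ f).quotKerEquivOfSurjective hs).symm.trans
        (Submodule.quotEquivOfEq _ _ ?_))
      rw [LinearMap.ker_comp, Submodule.ker_mkQ]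

lemma isTorsionClass_filt [IsNoetherianRing A]
    (hq : ∀ (M N : Type u) [AddCommGroup M] [Module A M] [AddCommGroup N] [Module A N]
        (f : M →ₗ[A] N), Function.Surjective f → Mem C M → Mem C N) :
    IsTorsionClass (filt C) := by
  have := filt_replete (C := C)
  refine isTorsionClass_of isExtensionClosed_filt this fun M N _ _ _ _ f hf hM => ?_
  have key := hM.filt_induction
    (fun M _ _ => ∀ (N : Type u) [AddCommGroup N] [Module A N] (f : M →ₗ[A] N),
      Function.Surjective f → Mem (filt C) N) ?_ ?_ ?_
  · exact key N f hf
  · intro M M' _ _ _ _ e h N _ _ f hf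
    exact h N (f ∘ₗ e.toLinearMap) (hf.comp e.surjective)
  · intro M _ _ _ N _ _ f hf
    have := hf.subsingleton
    exact mem_filt_of_subsingleton
  · intro M _ _ P h hP N _ _ f hf
    refine mem_filt_of_submodule (P.map f) (h _ (f.submoduleMap P) (f.submoduleMap_surjective P)) ?_
    refine hq _ _ (P.mapQ (P.map f) f (Submodule.le_comap_map f P)) ?_ hP
    intro y
    obtain ⟨z, rfl⟩ := (P.map f).mkQ_surjective y
    obtain ⟨x, rfl⟩ := hf z
    exact ⟨P.mkQ x, rfl⟩

/-- A torsion class containing `C` contains `filt C`. -/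
lemma IsExtensionClosed.filt_le {T : ObjectProperty (FGModuleCat.{u} A)}
    (hT : IsExtensionClosed T) (hCT : ∀ (M : Type u) [AddCommGroup M] [Module A M],
      Mem C M → Mem T M) (h : Mem (filt C) M) : Mem T M :=
  h.filt_induction (fun M _ _ => Mem T M) (fun _ _ _ _ _ _ e hM => hM.of_equiv e)
    (fun _ _ _ _ => hT.of_subsingleton) (fun M _ _ P hP hQ => hT.ext M P hP (hCT _ hQ))

/-- The first nonzero step of a filtration is isomorphic to its own subquotient. -/
lemma Mem.exists_submodule_of_filt [Nontrivial M] (h : Mem (ModSubcat.filt C) M) :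
    ∃ P : Submodule A M, P ≠ ⊥ ∧ Mem C P := by
  have key := h.filt_induction
    (fun M _ _ => Nontrivial M → ∃ P : Submodule A M, P ≠ ⊥ ∧ Mem C P) ?_ ?_ ?_
  · exact key inferInstance
  · intro M N _ _ _ _ e h hN
    obtain ⟨P, hP, hC⟩ := h e.toEquiv.nontrivial
    refine ⟨P.map e.toLinearMap, ?_, hC.of_equiv (e.submoduleMap P)⟩
    exact map_ne_bot e.injective hP
  · intro M _ _ h h'
    exact absurd h (not_subsingleton_iff_nontrivial.2 h')
  · intro M _ _ P h hQ hM
    by_cases hP : P = ⊥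
    · refine ⟨⊤, top_ne_bot, ?_⟩
      exact hQ.of_equiv ((Submodule.quotEquivOfEqBot P hP).trans Submodule.topEquiv.symm)
    · obtain ⟨R, hR, hC⟩ := h (Submodule.nontrivial_iff_ne_bot.2 hP)
      refine ⟨R.map P.subtype, ?_, hC.of_equiv
        (Submodule.equivMapOfInjective _ P.subtype_injective R)⟩
      exact map_ne_bot P.subtype_injective hR

end Filt

section Gen

variable {C : ObjectProperty (FGModuleCat.{u} A)}
  {M N : Type u} [AddCommGroup M] [Module A M] [AddCommGroup N] [Module A N]

lemma gen_quotient (M N : Type u) [AddCommGroup M] [Module A M] [AddCommGroup N] [Module A N]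
    (f : M →ₗ[A] N) (hf : Function.Surjective f) (hM : Mem (gen C) M) : Mem (gen C) N := by
  have := hM.finite
  have : Module.Finite A N := Module.Finite.of_surjective f hf
  obtain ⟨X, ⟨n, P, g, hP, hg⟩, ⟨e⟩⟩ := hM
  exact ⟨FGModuleCat.of A N, ⟨n, P, (f ∘ₗ e.toLinearMap) ∘ₗ g, hP,
    (hf.comp e.surjective).comp hg⟩, ⟨LinearEquiv.refl A N⟩⟩

lemma Mem.gen (h : Mem C M) : Mem (gen C) M := by
  have := h.finite
  obtain ⟨X, hX, ⟨e⟩⟩ := h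
  refine ⟨FGModuleCat.of A M, ⟨1, fun _ => X, e.toLinearMap ∘ₗ LinearMap.proj 0, fun _ => hX, ?_⟩,
    ⟨LinearEquiv.refl A M⟩⟩
  exact e.surjective.comp fun x => ⟨fun _ => x, rfl⟩

/-- Finite direct sums stay in an extension-closed `C`, so one object suffices as a source. -/
lemma IsExtensionClosed.exists_of_mem_gen (hC : IsExtensionClosed C) (h : Mem (ModSubcat.gen C) M) :
    ∃ (X : FGModuleCat.{u} A) (f : X →ₗ[A] M), Mem C X ∧ Function.Surjective f := by
  obtain ⟨X, ⟨n, P, g, hP, hg⟩, ⟨e⟩⟩ := h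
  obtain ⟨Y, hY, ⟨e'⟩⟩ := hC.pi (fun i => P i) (fun i => mem_of_prop (hP i))
  exact ⟨Y, (e.toLinearMap ∘ₗ g) ∘ₗ e'.toLinearMap, mem_of_prop hY,
    (e.surjective.comp hg).comp e'.surjective⟩

end Gen

end ModSubcat

namespace ModSubcat

variable {A : Type u} [Ring A]

lemma isTorsionClass_filt_gen [IsNoetherianRing A] (C : ObjectProperty (FGModuleCat.{u} A)) :
    IsTorsionClass (filt (gen C)) :=
  isTorsionClass_filt gen_quotient

/-! ### Wide subcategories and the torsion classes they generate -/

namespace IsWideMem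

variable {W : ObjectProperty (FGModuleCat.{u} A)} (hW : IsWideMem W)
  {M N : Type u} [AddCommGroup M] [Module A M] [AddCommGroup N] [Module A N]

include hW

lemma isExtensionClosed : IsExtensionClosed W := ⟨hW.zero, hW.ext⟩

lemma quotient {P : Submodule A M} (hP : Mem W P) (hM : Mem W M) : Mem W (M ⧸ P) := by
  have h := hW.coker _ _ P.subtype hP hM
  rwa [Submodule.range_subtype] at h

lemma range (f : M →ₗ[A] N) (hM : Mem W M) (hN : Mem W N) : Mem W (LinearMap.range f) := by
  have h := hW.ker _ _ (LinearMap.range f).mkQ hN (hW.coker _ _ f hM hN)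
  rwa [Submodule.ker_mkQ] at h

/-- Induction on the filtration. Once the image of `P` lies in `W`, the induced map `g'` has its
target in `W`, and composing it with an epimorphism from an object of `W` puts its range in `W` and
its kernel in `gen W`. Range and kernel of `g` are extensions of those of `g'` by those of `g`
restricted to `P`. -/
lemma range_and_ker_of_filt_gen (hN : Mem W N) (hM : Mem (filt (gen W)) M) (g : M →ₗ[A] N) :
    Mem W (LinearMap.range g) ∧ Mem (filt (gen W)) (LinearMap.ker g) := by
  have hE := hW.isExtensionClosed
  have hF := isExtensionClosed_filt (C := gen W)
  have key := hM.filt_induction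
    (fun M _ _ => ∀ g : M →ₗ[A] N,
      Mem W (LinearMap.range g) ∧ Mem (filt (gen W)) (LinearMap.ker g)) ?_ ?_ ?_
  · exact key g
  · intro M M' _ _ _ _ e h g
    obtain ⟨h1, h2⟩ := h (g ∘ₗ e.toLinearMap)
    rw [LinearMap.range_comp_of_range_eq_top _ e.range] at h1
    refine ⟨h1, h2.of_equiv ?_⟩
    exact (LinearEquiv.ofEq _ _ (LinearMap.ker_comp _ _)).trans
      (e.ofSubmodule' (LinearMap.ker g))
  · intro M _ _ _ g
    have : Subsingleton (LinearMap.range g) := g.surjective_rangeRestrict.subsingleton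
    exact ⟨hE.of_subsingleton, hF.of_subsingleton⟩
  · intro M _ _ P h hQ g
    obtain ⟨h1, h2⟩ := h (g ∘ₗ P.subtype)
    rw [LinearMap.range_comp, Submodule.range_subtype] at h1
    let g' : (M ⧸ P) →ₗ[A] (N ⧸ P.map g) := P.mapQ (P.map g) g (Submodule.le_comap_map g P)
    obtain ⟨X, f, hX, hf⟩ := hE.exists_of_mem_gen hQ
    have hN' := hW.quotient h1 hN
    have hr : Mem W (LinearMap.range g') := by
      have := hW.range (g' ∘ₗ f) hX hN'
      rwa [LinearMap.range_comp_of_range_eq_top _ (LinearMap.range_eq_top.2 hf)] at this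
    have hk : Mem (gen W) (LinearMap.ker g') := by
      refine gen_quotient _ _ (f.restrict (p := LinearMap.ker (g' ∘ₗ f)) (q := LinearMap.ker g')
        fun x hx => hx) ?_ (hW.ker _ _ (g' ∘ₗ f) hX hN').gen
      rintro ⟨y, hy⟩
      obtain ⟨x, rfl⟩ := hf y
      exact ⟨⟨x, hy⟩, rfl⟩
    constructor
    · have hle : P.map g ≤ LinearMap.range g := LinearMap.map_le_range
      refine hE.of_exact (Submodule.inclusion hle) ((P.map g).mkQ.restrict
        (p := LinearMap.range g) (q := LinearMap.range g') ?_)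
        (Submodule.inclusion_injective hle) ?_ ?_ h1 hr
      · rintro _ ⟨x, rfl⟩
        exact ⟨P.mkQ x, rfl⟩
      · rintro ⟨_, y, rfl⟩
        obtain ⟨x, rfl⟩ := P.mkQ_surjective y
        exact ⟨⟨g x, x, rfl⟩, rfl⟩
      · intro x
        constructor
        · intro h
          exact ⟨⟨x, (Submodule.Quotient.mk_eq_zero _).1 (congr_arg Subtype.val h)⟩, rfl⟩
        · rintro ⟨z, rfl⟩
          exact Subtype.ext ((Submodule.Quotient.mk_eq_zero _).2 z.2)
    · refine hF.of_exact (P.subtype.restrict (p := LinearMap.ker (g ∘ₗ P.subtype))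
        (q := LinearMap.ker g) fun x hx => hx) (P.mkQ.restrict (p := LinearMap.ker g)
        (q := LinearMap.ker g') ?_) ?_ ?_ ?_ h2 hk.filt
      · intro x hx
        change (P.map g).mkQ (g x) = 0
        rw [LinearMap.mem_ker.1 hx, map_zero]
      · intro x y hxy
        have h : ((x : P) : M) = ((y : P) : M) := by
          have h' := congr_arg Subtype.val hxy
          exact h'
        exact Subtype.ext (Subtype.ext h)
      · rintro ⟨y, hy⟩
        obtain ⟨x, rfl⟩ := P.mkQ_surjective y
        obtain ⟨p, hp, hpx⟩ := (Submodule.Quotient.mk_eq_zero (P.map g)).1 hy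
        -- Subtracting `p` from `P` with `g p = g x` moves the lift into the kernel of `g` without
        -- changing its class.
        refine ⟨⟨x - p, by simp [hpx]⟩, Subtype.ext ?_⟩
        change P.mkQ (x - p) = P.mkQ x
        have h0 : P.mkQ p = 0 := (Submodule.Quotient.mk_eq_zero P).2 hp
        rw [map_sub, h0, sub_zero]
      · intro x
        constructor
        · intro h
          exact ⟨⟨⟨x, (Submodule.Quotient.mk_eq_zero P).1 (congr_arg Subtype.val h)⟩, x.2⟩, rfl⟩
        · rintro ⟨z, rfl⟩
          exact Subtype.ext ((Submodule.Quotient.mk_eq_zero P).2 z.1.2)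

end IsWideMem

/-! ### The wide subcategory of a torsion class -/

section Alpha

variable {T : ObjectProperty (FGModuleCat.{u} A)}
  {M N : Type u} [AddCommGroup M] [Module A M] [AddCommGroup N] [Module A N]

lemma mem_alpha_iff [T.IsClosedUnderIsomorphisms] :
    Mem (alpha T) M ↔ Mem T M ∧ ∀ (Y : Type u) [AddCommGroup Y] [Module A Y] (g : Y →ₗ[A] M),
      Mem T Y → Mem T (LinearMap.ker g) := by
  constructor
  · rintro ⟨X, ⟨hX, h⟩, ⟨e⟩⟩
    refine ⟨(mem_of_prop hX).of_equiv e, fun Y _ _ g hY => ?_⟩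
    have := hY.finite
    have := h (FGModuleCat.of A Y) (mem_iff.1 hY) (e.symm.toLinearMap ∘ₗ g)
    rwa [LinearEquiv.ker_comp] at this
  · rintro ⟨hM, h⟩
    have := hM.finite
    exact mem_of_prop (X := FGModuleCat.of A M)
      ⟨mem_iff.1 hM, fun Y hY g => h Y g (mem_of_prop hY)⟩

lemma alpha_replete [T.IsClosedUnderIsomorphisms] : (alpha T).IsClosedUnderIsomorphisms :=
  isClosedUnderIsomorphisms_of fun X Y hX ⟨e⟩ => by
    refine ⟨mem_iff.1 ((mem_of_prop hX.1).of_equiv e), fun Z hZ g => ?_⟩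
    have := hX.2 Z hZ (e.symm.toLinearMap ∘ₗ g)
    rwa [LinearEquiv.ker_comp] at this

lemma alpha_of_injective [T.IsClosedUnderIsomorphisms] (j : N →ₗ[A] M)
    (hj : Function.Injective j) (hN : Mem T N) (hM : Mem (alpha T) M) : Mem (alpha T) N := by
  refine mem_alpha_iff.2 ⟨hN, fun Y _ _ g hY => ?_⟩
  have := (mem_alpha_iff.1 hM).2 Y (j ∘ₗ g) hY
  rwa [LinearMap.ker_comp_of_ker_eq_bot _ (LinearMap.ker_eq_bot.2 hj)] at this

/-- Ingalls and Thomas: `alpha T` is wide. -/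
theorem IsTorsionClass.isWideMem_alpha [IsNoetherianRing A] (hT : IsTorsionClass T) : IsWideMem (alpha T) := by
  have := hT.replete
  have hE := hT.isExtensionClosed
  refine ⟨alpha_replete, ?_, ?_, ?_, ?_⟩
  · refine mem_alpha_iff.2 ⟨hE.zero, fun Y _ _ g hY => ?_⟩
    have : LinearMap.ker g = ⊤ := by
      ext x
      simp
    rw [this]
    exact hY.of_equiv Submodule.topEquiv.symm
  · intro M N _ _ _ _ f hM hN
    exact alpha_of_injective (LinearMap.ker f).subtype (Submodule.subtype_injective _)
      ((mem_alpha_iff.1 hN).2 M f (mem_alpha_iff.1 hM).1) hM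
  · intro M N _ _ _ _ f hM hN
    rw [mem_alpha_iff] at hM hN ⊢
    refine ⟨hT.quotient _ (Submodule.mkQ_surjective _) hN.1, fun Y _ _ g hY => ?_⟩
    -- The pullback of `Y` and `N` over the cokernel is an extension of `Y` by the range of `f`,
    -- hence lies in `T`; its projection to `N` has kernel isomorphic to `ker g`.
    let P : Submodule A (Y × N) := LinearMap.eqLocus (g ∘ₗ LinearMap.fst A Y N)
      ((LinearMap.range f).mkQ ∘ₗ LinearMap.snd A Y N)
    have hP : Mem T P := by
      refine hE.of_surjective (LinearMap.fst A Y N ∘ₗ P.subtype) ?_ ?_ hY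
      · intro y
        obtain ⟨z, hz⟩ := (LinearMap.range f).mkQ_surjective (g y)
        exact ⟨⟨(y, z), hz.symm⟩, rfl⟩
      · refine hT.quotient (((LinearMap.inr A Y N ∘ₗ f).codRestrict P fun x => ?_).codRestrict
          (LinearMap.ker (LinearMap.fst A Y N ∘ₗ P.subtype)) fun x => rfl) ?_ hM.1
        · change g 0 = (LinearMap.range f).mkQ (f x)
          rw [map_zero]
          exact ((Submodule.Quotient.mk_eq_zero (LinearMap.range f)).2 ⟨x, rfl⟩).symm
        · rintro ⟨⟨⟨y, z⟩, hyz⟩, hy⟩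
          obtain rfl : y = 0 := hy
          obtain ⟨x, rfl⟩ : z ∈ LinearMap.range f := by
            rw [← Submodule.Quotient.mk_eq_zero]
            exact (hyz.symm.trans (map_zero g) :)
          exact ⟨x, rfl⟩
    refine hT.quotient ((LinearMap.fst A Y N ∘ₗ P.subtype).restrict
      (p := LinearMap.ker (LinearMap.snd A Y N ∘ₗ P.subtype)) (q := LinearMap.ker g) ?_) ?_
      (hN.2 _ _ hP)
    · rintro ⟨⟨y, z⟩, hyz⟩ hz
      obtain rfl : z = 0 := hz
      exact (hyz.trans (map_zero (LinearMap.range f).mkQ) :)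
    · rintro ⟨y, hy⟩
      exact ⟨⟨⟨(y, 0), hy.trans (map_zero (LinearMap.range f).mkQ).symm⟩, rfl⟩, rfl⟩
  · intro M _ _ N hN hQ
    rw [mem_alpha_iff] at hN hQ ⊢
    refine ⟨hT.isExtensionClosed.ext M N hN.1 hQ.1, fun Y _ _ g hY => ?_⟩
    have h1 := hQ.2 Y (N.mkQ ∘ₗ g) hY
    let g' : LinearMap.ker (N.mkQ ∘ₗ g) →ₗ[A] N :=
      g.restrict fun x hx => (Submodule.Quotient.mk_eq_zero N).1 hx
    have h2 := hN.2 _ g' h1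
    refine hT.quotient ((LinearMap.ker (N.mkQ ∘ₗ g)).subtype.restrict (p := LinearMap.ker g')
      (q := LinearMap.ker g) fun x hx => congr_arg Subtype.val (LinearMap.mem_ker.1 hx)) ?_ h2
    rintro ⟨y, hy⟩
    refine ⟨⟨⟨y, ?_⟩, Subtype.ext hy⟩, rfl⟩
    change N.mkQ (g y) = 0
    rw [LinearMap.mem_ker.1 hy, map_zero]

/-- Marks and Šťovíček: a wide subcategory is recovered from the torsion class it generates. -/
theorem IsWideMem.alpha_filt_gen [IsNoetherianRing A] {W : ObjectProperty (FGModuleCat.{u} A)} (hW : IsWideMem W) :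
    alpha (filt (gen W)) = W := by
  have hT := isTorsionClass_filt_gen W
  have := hT.replete
  have hα := hT.isWideMem_alpha
  have := hα.replete
  have := hW.replete
  have hWα : ∀ (M : Type u) [AddCommGroup M] [Module A M], Mem W M →
      Mem (alpha (filt (gen W))) M := fun M _ _ hM =>
    mem_alpha_iff.2 ⟨hM.gen.filt, fun Y _ _ g hY => (hW.range_and_ker_of_filt_gen hM hY g).2⟩
  refine eq_of_mem_iff fun M _ _ => ⟨fun hM => ?_, hWα M⟩
  have := hM.finite
  obtain ⟨P, hP, hmax⟩ := set_has_maximal_iff_noetherian.2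
    (inferInstance : IsNoetherian A M) {P : Submodule A M | Mem W P}
    ⟨⊥, hW.isExtensionClosed.of_subsingleton⟩
  by_cases hPt : P = ⊤
  · subst hPt
    exact Mem.of_equiv (C := W) hP Submodule.topEquiv
  exfalso
  have hPα := hα.quotient (hWα P hP) hM
  have : Nontrivial (M ⧸ P) := Submodule.Quotient.nontrivial_iff.2 hPt
  obtain ⟨R, hR, hRg⟩ := (mem_alpha_iff.1 hPα).1.exists_submodule_of_filt
  obtain ⟨X, f, hX, hf⟩ := hW.isExtensionClosed.exists_of_mem_gen hRg
  -- As `M ⧸ P` lies in `alpha`, the kernel of `X → R ⊆ M ⧸ P` is in the torsion class; being also a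
  -- submodule of `X` in `W`, it is the range of its inclusion and so lies in `W`. Thus `R` lies in
  -- `W` and enlarges `P`.
  have hk : Mem (filt (gen W)) (LinearMap.ker f) := by
    have := (mem_alpha_iff.1 hPα).2 X (R.subtype ∘ₗ f) hX.gen.filt
    rwa [LinearMap.ker_comp_of_ker_eq_bot _ R.ker_subtype] at this
  have hkW : Mem W (LinearMap.ker f) := by
    have := (hW.range_and_ker_of_filt_gen hX hk (LinearMap.ker f).subtype).1
    rwa [Submodule.range_subtype] at this
  have hRW : Mem W R := (hW.quotient hkW hX).of_equiv (f.quotKerEquivOfSurjective hf)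
  exact hmax _ (hW.isExtensionClosed.comap_mkQ hP hRW)
    (lt_of_le_not_ge (Submodule.le_comap_mkQ P R) fun h => hR (eq_bot_of_comap_mkQ_le h))

end Alpha

end ModSubcat

namespace ModSubcat

variable {A : Type u} [Ring A]

/-! ### Minimal torsion-free objects over a maximal torsion subclass -/

section TorsionFree

variable {U T : ObjectProperty (FGModuleCat.{u} A)}
  {M N : Type u} [AddCommGroup M] [Module A M] [AddCommGroup N] [Module A N]

/-- `M` has no nonzero submodule in `U`. -/
def IsTorsionFree (U : ObjectProperty (FGModuleCat.{u} A)) (M : Type u) [AddCommGroup M]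
    [Module A M] : Prop :=
  ∀ P : Submodule A M, Mem U P → P = ⊥

lemma IsTorsionFree.of_injective (h : IsTorsionFree U M) (j : N →ₗ[A] M)
    (hj : Function.Injective j) : IsTorsionFree U N := fun P hP => by
  by_contra hne
  exact map_ne_bot hj hne (h _ (hP.of_equiv (Submodule.equivMapOfInjective j hj P)))

lemma IsTorsionFree.not_mem [Nontrivial M] (h : IsTorsionFree U M) : ¬ Mem U M := fun hM =>
  top_ne_bot (h ⊤ (hM.of_equiv Submodule.topEquiv.symm))

/-- `B` is a nonzero `U`-torsion-free module in `T` of minimal length. -/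
structure IsMinimalTorsionFree (T U : ObjectProperty (FGModuleCat.{u} A)) (B : Type u)
    [AddCommGroup B] [Module A B] : Prop where
  mem : Mem T B
  torsionFree : IsTorsionFree U B
  nontrivial : Nontrivial B
  minimal : ∀ (N : Type u) [AddCommGroup N] [Module A N], Mem T N → IsTorsionFree U N →
    Nontrivial N → Module.length A B ≤ Module.length A N

variable [IsNoetherianRing A]

lemma exists_isMinimalTorsionFree (hT : IsTorsionClass T) (hU : IsTorsionClass U)
    (hM : Mem T M) (hMU : ¬ Mem U M) :
    ∃ B : FGModuleCat.{u} A, IsMinimalTorsionFree T U B := by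
  let S : Set (FGModuleCat.{u} A) := {X | Mem T X ∧ IsTorsionFree U X ∧ Nontrivial X}
  have hS : S.Nonempty := by
    have := hM.finite
    obtain ⟨t, ht, -, htf⟩ := hU.exists_torsion (M := M)
    refine ⟨FGModuleCat.of A (M ⧸ t), hT.quotient t.mkQ t.mkQ_surjective hM, htf,
      Submodule.Quotient.nontrivial_iff.2 fun h => hMU ?_⟩
    rw [h] at ht
    exact ht.of_equiv Submodule.topEquiv
  obtain ⟨B, ⟨h1, h2, h3⟩, hB⟩ :=
    (InvImage.wf (fun X : FGModuleCat.{u} A => Module.length A X) wellFounded_lt).has_min S hS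
  refine ⟨B, h1, h2, h3, fun N _ _ hN hNU hN0 => ?_⟩
  obtain ⟨X, hX, ⟨e⟩⟩ := id hN
  rw [← e.length_eq]
  exact not_lt.1 (hB X ⟨mem_of_prop hX, hNU.of_injective e.toLinearMap e.injective,
    e.toEquiv.nontrivial⟩)

end TorsionFree

section Cover

variable [IsNoetherianRing A] [IsArtinianRing A] {U T : ObjectProperty (FGModuleCat.{u} A)}
  {B : Type u} [AddCommGroup B] [Module A B]

namespace IsMinimalTorsionFree

lemma eq_top (h : IsMinimalTorsionFree T U B) {P : Submodule A B} (hP : Mem T P)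
    (hne : P ≠ ⊥) : P = ⊤ := by
  have := h.mem.finite
  by_contra htop
  exact (Submodule.length_lt htop).not_ge (h.minimal P hP
    (h.torsionFree.of_injective P.subtype P.subtype_injective)
    (Submodule.nontrivial_iff_ne_bot.2 hne))

/-- A nonzero kernel would make the range a shorter nonzero torsion-free object of `T`. -/
lemma injective_of_ne_zero (h : IsMinimalTorsionFree T U B) (hT : IsTorsionClass T)
    {N : Type u} [AddCommGroup N] [Module A N] (hN : IsTorsionFree U N) (f : B →ₗ[A] N)
    (hf : f ≠ 0) : Function.Injective f := by
  have := h.mem.finite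
  rw [← LinearMap.ker_eq_bot]
  by_contra hne
  have h1 := h.minimal (LinearMap.range f) (hT.range f h.mem)
    (hN.of_injective _ (Submodule.subtype_injective _))
    (Submodule.nontrivial_iff_ne_bot.2 fun h => hf (LinearMap.range_eq_bot.1 h))
  rw [← f.quotKerEquivRange.length_eq] at h1
  exact (Submodule.length_quotient_lt _ hne).not_ge h1

/-- Assume that `T` is the only torsion class between `U` and `T` that contains `B`. If the kernel
of an epimorphism `g : Y ⟶ B` with `Y` in `T` has no nonzero submodules in `T`, then it
vanishes. -/
lemma ker_eq_bot (h : IsMinimalTorsionFree T U B) (hT : IsTorsionClass T)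
    (hU : IsTorsionClass U) (hUT : U ≤ T)
    (hcov : ∀ V : ObjectProperty (FGModuleCat.{u} A), IsTorsionClass V → U ≤ V → V ≤ T →
      Mem V B → T ≤ V)
    {Y : Type u} [AddCommGroup Y] [Module A Y] (hY : Mem T Y) (g : Y →ₗ[A] B)
    (hg : Function.Surjective g)
    (hK : ∀ P : Submodule A Y, P ≤ LinearMap.ker g → Mem T P → P = ⊥) :
    LinearMap.ker g = ⊥ := by
  have := h.nontrivial
  have := hT.replete
  have hYU : IsTorsionFree U Y := fun P hP => by
    refine hK P (fun x hx => ?_) (hP.mono hUT)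
    have h0 := h.torsionFree _ (hU.range (g ∘ₗ P.subtype) hP)
    exact LinearMap.congr_fun (LinearMap.range_eq_bot.1 h0) ⟨x, hx⟩
  -- `filt D` is a torsion class between `U` and `T` containing `B`, so it contains `T`. Since `Y`
  -- is `U`-torsion-free, it must have a nonzero submodule that is a quotient of `B`.
  let D : ObjectProperty (FGModuleCat.{u} A) := fun X =>
    U X ∨ ∃ f : B →ₗ[A] X, Function.Surjective f
  have hDq : ∀ (M N : Type u) [AddCommGroup M] [Module A M] [AddCommGroup N] [Module A N]
      (f : M →ₗ[A] N), Function.Surjective f → Mem D M → Mem D N := by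
    rintro M N _ _ _ _ f hf ⟨X, hX | ⟨p, hp⟩, ⟨e⟩⟩
    · exact (hU.quotient (f ∘ₗ e.toLinearMap) (hf.comp e.surjective) (mem_of_prop hX)).mono
        fun _ => Or.inl
    · have : Module.Finite A N :=
        Module.Finite.of_surjective (f ∘ₗ e.toLinearMap) (hf.comp e.surjective)
      exact mem_of_prop (X := FGModuleCat.of A N) (Or.inr ⟨(f ∘ₗ e.toLinearMap) ∘ₗ p,
        (hf.comp e.surjective).comp hp⟩)
  have hDB : Mem D B := by
    have := h.mem.finite
    exact mem_of_prop (X := FGModuleCat.of A B) (Or.inr ⟨LinearMap.id, fun x => ⟨x, rfl⟩⟩)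
  have hDT : ∀ (M : Type u) [AddCommGroup M] [Module A M], Mem D M → Mem T M := by
    rintro M _ _ ⟨X, hX | ⟨p, hp⟩, ⟨e⟩⟩
    · exact (mem_of_prop (hUT X hX)).of_equiv e
    · exact (hT.quotient p hp h.mem).of_equiv e
  have hV := isTorsionClass_filt hDq
  have := hV.replete
  have hTV := hcov _ hV (fun X hX => mem_iff.1 (Mem.filt (mem_of_prop (C := D) (Or.inl hX))))
    (le_of_mem_imp fun M _ _ hM => hT.isExtensionClosed.filt_le hDT hM) hDB.filt
  have := hg.nontrivial
  obtain ⟨P, hP, X, hX | ⟨p, hp⟩, ⟨e⟩⟩ := (hY.mono hTV).exists_submodule_of_filt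
  · exact absurd (hYU P ((mem_of_prop hX).of_equiv e)) hP
  let f : B →ₗ[A] Y := P.subtype ∘ₗ e.toLinearMap ∘ₗ p
  have hfP : LinearMap.range f = P := by
    rw [LinearMap.range_comp_of_range_eq_top, Submodule.range_subtype]
    exact LinearMap.range_eq_top.2 (e.surjective.comp hp)
  have hgf : g ∘ₗ f ≠ 0 := fun h0 => by
    refine hP (hK P ?_ ?_)
    · rw [← hfP]
      exact LinearMap.range_le_ker_iff.2 h0
    · rw [← hfP]
      exact hT.range f h.mem
  have hi := h.injective_of_ne_zero hT h.torsionFree _ hgf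
  have hs : Function.Surjective (g ∘ₗ f) := LinearMap.range_eq_top.1
    (h.eq_top (hT.range _ h.mem) fun h0 => hgf (LinearMap.range_eq_bot.1 h0))
  -- The composite `g ∘ₗ f` is an automorphism of `B`, so `g` splits. The projection `q` of `Y` onto
  -- `ker g` has its image in `T`, hence vanishes.
  let φ := LinearEquiv.ofBijective (g ∘ₗ f) ⟨hi, hs⟩
  let q : Y →ₗ[A] Y := LinearMap.id - f ∘ₗ φ.symm.toLinearMap ∘ₗ g
  have hq : LinearMap.range q = ⊥ := by
    refine hK _ ?_ (hT.range q hY)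
    rintro _ ⟨y, rfl⟩
    have : g (f (φ.symm (g y))) = g y := φ.apply_symm_apply (g y)
    simp [q, this]
  rw [LinearMap.ker_eq_bot']
  intro y hy
  have := LinearMap.congr_fun (LinearMap.range_eq_bot.1 hq) y
  simpa [q, hy] using this

/-- Dividing `Y` by the `T`-torsion part `t` of `ker g` reduces to `ker_eq_bot`, which shows that
`ker g` is `t` itself. -/
lemma mem_alpha (h : IsMinimalTorsionFree T U B) (hT : IsTorsionClass T)
    (hU : IsTorsionClass U) (hUT : U ≤ T)
    (hcov : ∀ V : ObjectProperty (FGModuleCat.{u} A), IsTorsionClass V → U ≤ V → V ≤ T →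
      Mem V B → T ≤ V) : Mem (alpha T) B := by
  have := hT.replete
  refine mem_alpha_iff.2 ⟨h.mem, fun Y _ _ g hY => ?_⟩
  by_cases hg0 : g = 0
  · rw [hg0, LinearMap.ker_zero]
    exact hY.of_equiv Submodule.topEquiv.symm
  have hg : Function.Surjective g := LinearMap.range_eq_top.1
    (h.eq_top (hT.range _ hY) fun h0 => hg0 (LinearMap.range_eq_bot.1 h0))
  have := hY.finite
  obtain ⟨t, ⟨htK, ht⟩, hmax⟩ := set_has_maximal_iff_noetherian.2
    (inferInstance : IsNoetherian A Y) {P : Submodule A Y | P ≤ LinearMap.ker g ∧ Mem T P}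
    ⟨⊥, bot_le, hT.isExtensionClosed.of_subsingleton⟩
  have hker := h.ker_eq_bot hT hU hUT hcov (hT.quotient t.mkQ t.mkQ_surjective hY)
    (t.liftQ g htK) (fun b => by
      obtain ⟨y, rfl⟩ := hg b
      exact ⟨t.mkQ y, rfl⟩) (fun P hPK hP => ?_)
  · have : LinearMap.ker g = t := by
      refine le_antisymm (fun y hy => ?_) htK
      have : t.mkQ y ∈ LinearMap.ker (t.liftQ g htK) := hy
      rw [hker] at this
      exact (Submodule.Quotient.mk_eq_zero t).1 this
    rwa [this]
  · by_contra hne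
    refine hmax (P.comap t.mkQ) ⟨fun y hy => hPK hy, hT.isExtensionClosed.comap_mkQ ht hP⟩
      (lt_of_le_not_ge (Submodule.le_comap_mkQ t P) fun h => hne (eq_bot_of_comap_mkQ_le h))

end IsMinimalTorsionFree

end Cover

/-! ### Functorially finite torsion classes are generated by their wide subcategories -/

section Generator

lemma IsFunctoriallyFinite.exists_left {C : ObjectProperty (FGModuleCat.{u} A)}
    (hC : IsFunctoriallyFinite C) (M : Type u) [AddCommGroup M] [Module A M] [Module.Finite A M] :
    ∃ (L : FGModuleCat.{u} A) (g : M →ₗ[A] L), Mem C L ∧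
      ∀ (N : Type u) [AddCommGroup N] [Module A N], Mem C N → ∀ f : M →ₗ[A] N,
        ∃ f' : L →ₗ[A] N, f' ∘ₗ g = f := by
  obtain ⟨L, g, hL, h⟩ := hC.exists_left_approximation (FGModuleCat.of A M)
  refine ⟨L, g.hom.hom, mem_of_prop hL, ?_⟩
  rintro N _ _ ⟨X, hX, ⟨e⟩⟩ f
  obtain ⟨f', hf'⟩ := h X hX (toHom (X := FGModuleCat.of A M) (e.symm.toLinearMap ∘ₗ f))
  refine ⟨e.toLinearMap ∘ₗ f'.hom.hom, ?_⟩
  ext x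
  have := congr($(hf').hom.hom x)
  exact (congr_arg e this).trans (e.apply_symm_apply (f x))

/-- If every element of a module in `C` is the value at `r` of a linear map from `R`, then `R`
generates `C`. -/
lemma exists_surjective_pi {R : Type u} [AddCommGroup R] [Module A R] (r : R)
    {M : Type u} [AddCommGroup M] [Module A M] [Module.Finite A M]
    (h : ∀ m : M, ∃ f : R →ₗ[A] M, f r = m) :
    ∃ (n : ℕ) (p : (Fin n → R) →ₗ[A] M), Function.Surjective p := by
  obtain ⟨n, q, hq⟩ := Module.Finite.exists_fin' A M
  choose f hf using h
  -- The `i`-th copy of `R` maps by a map taking `r` to the `i`-th generator of `M`.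
  refine ⟨n, ∑ i, f (q fun j => if i = j then 1 else 0) ∘ₗ LinearMap.proj i, fun m => ?_⟩
  obtain ⟨v, rfl⟩ := hq m
  refine ⟨fun i => v i • r, ?_⟩
  rw [LinearMap.pi_apply_eq_sum_univ q v]
  simp [LinearMap.sum_apply, hf]

variable [IsNoetherianRing A]

/-- A torsion class generated by a single object contains maximal proper torsion subclasses. -/
lemma exists_maximal_torsionClass {T U : ObjectProperty (FGModuleCat.{u} A)}
    (X : FGModuleCat.{u} A) (hU : IsTorsionClass U) (hUT : U ≤ T) (hX : ¬ Mem U X) :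
    ∃ V, U ≤ V ∧ Maximal (· ∈ {V : ObjectProperty (FGModuleCat.{u} A) |
      IsTorsionClass V ∧ V ≤ T ∧ ¬ Mem V X}) V := by
  refine zorn_le_nonempty₀ _ (fun c hc hchain V₀ hV₀ => ?_) U ⟨hU, hUT, hX⟩
  let V : ObjectProperty (FGModuleCat.{u} A) := fun X => ∃ Z ∈ c, Z X
  have hV : ∀ (M : Type u) [AddCommGroup M] [Module A M], Mem V M ↔ ∃ Z ∈ c, Mem Z M := by
    intro M _ _
    constructor
    · rintro ⟨Y, ⟨Z, hZ, hY⟩, e⟩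
      exact ⟨Z, hZ, Y, hY, e⟩
    · rintro ⟨Z, hZ, Y, hY, e⟩
      exact ⟨Y, ⟨Z, hZ, hY⟩, e⟩
  have hr : V.IsClosedUnderIsomorphisms := ⟨fun e ⟨Z, hZ, hX⟩ =>
    have := (hc hZ).1.replete
    ⟨Z, hZ, Z.prop_of_iso e hX⟩⟩
  refine ⟨V, ⟨isTorsionClass_of ⟨?_, ?_⟩ hr ?_, ?_, ?_⟩, fun Z hZ X hX => ⟨Z, hZ, hX⟩⟩
  · exact (hV _).2 ⟨V₀, hV₀, (hc hV₀).1.isExtensionClosed.zero⟩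
  · intro M _ _ N hN hQ
    obtain ⟨Z₁, hZ₁, hN⟩ := (hV _).1 hN
    obtain ⟨Z₂, hZ₂, hQ⟩ := (hV _).1 hQ
    rcases hchain.total hZ₁ hZ₂ with h | h
    · exact (hV _).2 ⟨Z₂, hZ₂, (hc hZ₂).1.isExtensionClosed.ext M N (hN.mono h) hQ⟩
    · exact (hV _).2 ⟨Z₁, hZ₁, (hc hZ₁).1.isExtensionClosed.ext M N hN (hQ.mono h)⟩
  · intro M N _ _ _ _ f hf hM
    obtain ⟨Z, hZ, hM⟩ := (hV _).1 hM
    exact (hV _).2 ⟨Z, hZ, (hc hZ).1.quotient f hf hM⟩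
  · rintro Y ⟨Z, hZ, hY⟩
    exact (hc hZ).2.1 Y hY
  · intro h
    obtain ⟨Z, hZ, hX⟩ := (hV _).1 h
    exact (hc hZ).2.2 hX

/-- A functorially finite torsion class is generated by its wide subcategory `alpha T`. -/
theorem IsTorsionClass.filt_gen_alpha [IsArtinianRing A] {T : ObjectProperty (FGModuleCat.{u} A)}
    (hT : IsTorsionClass T) (hff : IsFunctoriallyFinite T) : filt (gen (alpha T)) = T := by
  have := hT.replete
  have hα := hT.isWideMem_alpha
  have hU := isTorsionClass_filt_gen (alpha T)
  have := hU.replete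
  have hle : filt (gen (alpha T)) ≤ T := by
    refine le_of_mem_imp fun M _ _ hM => hT.isExtensionClosed.filt_le (fun N _ _ hN => ?_) hM
    obtain ⟨X, f, hX, hf⟩ := hα.isExtensionClosed.exists_of_mem_gen hN
    exact hT.quotient f hf (mem_alpha_iff.1 hX).1
  refine le_antisymm hle ?_
  obtain ⟨L, g, hL, h⟩ := hff.exists_left A
  -- Maps from `A` to an object of `T` extend along `g`, so each element of the object is the value
  -- at `g 1` of a map from `L`.
  have hgen : ∀ V : ObjectProperty (FGModuleCat.{u} A), IsTorsionClass V → Mem V L → T ≤ V := by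
    intro V hV hVL
    have := hV.replete
    refine le_of_mem_imp fun M _ _ hM => ?_
    have := hM.finite
    obtain ⟨n, p, hp⟩ := exists_surjective_pi (M := M) (g 1) fun m => by
      obtain ⟨f, hf⟩ := h M hM (LinearMap.toSpanSingleton A M m)
      exact ⟨f, by simpa using LinearMap.congr_fun hf 1⟩
    exact hV.quotient p hp (hV.isExtensionClosed.pi _ fun _ => hVL)
  refine hgen _ hU ?_
  by_contra hLU
  obtain ⟨V, hUV, ⟨hV, hVT, hLV⟩, hmax⟩ := exists_maximal_torsionClass L hU hle hLU
  obtain ⟨B, hB⟩ := exists_isMinimalTorsionFree hT hV hL hLV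
  have := hB.nontrivial
  refine hB.torsionFree.not_mem (((hB.mem_alpha hT hV hVT ?_).gen.filt).mono hUV)
  intro Z hZ hVZ hZT hBZ
  refine hgen Z hZ ?_
  by_contra hLZ
  exact hB.torsionFree.not_mem (hBZ.mono (hmax ⟨hZ, hZT, hLZ⟩ hVZ))

end Generator

end ModSubcat

namespace ModSubcat

variable {A : Type u} [Ring A]

/-! ### Approximations by wide subcategories -/

section Approximations

lemma isFunctoriallyFinite_of {C : ObjectProperty (FGModuleCat.{u} A)}
    (hl : ∀ M : FGModuleCat.{u} A, ∃ (L : FGModuleCat.{u} A) (g : M →ₗ[A] L), C L ∧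
      ∀ N : FGModuleCat.{u} A, C N → ∀ f : M →ₗ[A] N, ∃ f' : L →ₗ[A] N, f' ∘ₗ g = f)
    (hr : ∀ M : FGModuleCat.{u} A, ∃ (L : FGModuleCat.{u} A) (g : L →ₗ[A] M), C L ∧
      ∀ N : FGModuleCat.{u} A, C N → ∀ f : N →ₗ[A] M, ∃ f' : N →ₗ[A] L, g ∘ₗ f' = f) :
    IsFunctoriallyFinite C := by
  constructor
  · intro X
    obtain ⟨L, g, hL, h⟩ := hl X
    refine ⟨L, toHom g, hL, fun D hD f => ?_⟩
    obtain ⟨f', hf'⟩ := h D hD f.hom.hom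
    exact ⟨toHom f', by ext x; exact LinearMap.congr_fun hf' x⟩
  · intro X
    obtain ⟨L, g, hL, h⟩ := hr X
    refine ⟨L, toHom g, hL, fun D hD f => ?_⟩
    obtain ⟨f', hf'⟩ := h D hD f.hom.hom
    exact ⟨toHom f', by ext x; exact LinearMap.congr_fun hf' x⟩

variable [IsNoetherianRing A]

lemma IsTorsionClass.exists_left_alpha [IsArtinianRing A]
    {T : ObjectProperty (FGModuleCat.{u} A)}
    (hT : IsTorsionClass T) (hff : IsFunctoriallyFinite T) (M : Type u) [AddCommGroup M]
    [Module A M] [Module.Finite A M] :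
    ∃ (L : FGModuleCat.{u} A) (g : M →ₗ[A] L), Mem (alpha T) L ∧
      ∀ (N : Type u) [AddCommGroup N] [Module A N], Mem (alpha T) N → ∀ f : M →ₗ[A] N,
        ∃ f' : L →ₗ[A] N, f' ∘ₗ g = f := by
  have := hT.replete
  have hα := hT.isWideMem_alpha
  obtain ⟨L, g, hL, h⟩ := hff.exists_left M
  obtain ⟨P, hP, hmin⟩ := IsArtinian.set_has_minimal
    {P : Submodule A L | Mem (alpha T) (L ⧸ P)}
    ⟨⊤, hα.isExtensionClosed.of_subsingleton⟩
  refine ⟨FGModuleCat.of A (L ⧸ P), P.mkQ ∘ₗ g, hP, fun N _ _ hN f => ?_⟩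
  obtain ⟨f', rfl⟩ := h N (mem_alpha_iff.1 hN).1 f
  have hQ : Mem (alpha T) (L ⧸ LinearMap.ker f') :=
    (alpha_of_injective (LinearMap.range f').subtype (Submodule.subtype_injective _)
      (hT.range f' hL) hN).of_equiv f'.quotKerEquivRange.symm
  have hker : LinearMap.ker (P.mkQ.prod (LinearMap.ker f').mkQ) = P ⊓ LinearMap.ker f' := by
    rw [LinearMap.ker_prod, Submodule.ker_mkQ, Submodule.ker_mkQ]
  -- This quotient of `L` embeds into a product of two objects of `alpha T`; minimality of `P` then
  -- forces `P ≤ ker f'`.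
  have hinf : Mem (alpha T) (L ⧸ P ⊓ LinearMap.ker f') := by
    refine alpha_of_injective ((P ⊓ LinearMap.ker f').liftQ
      (P.mkQ.prod (LinearMap.ker f').mkQ) hker.ge) ?_
      (hT.quotient _ (Submodule.mkQ_surjective _) hL) (hα.isExtensionClosed.prod hP hQ)
    rw [← LinearMap.ker_eq_bot]
    exact Submodule.ker_liftQ_eq_bot _ _ _ hker.le
  have hle : P ≤ LinearMap.ker f' := by
    by_contra hle
    exact hmin _ hinf (inf_le_left.lt_of_ne fun h => hle (inf_eq_left.1 h))
  exact ⟨P.liftQ f' hle, by ext x; rfl⟩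

namespace IsWideMem

variable {W : ObjectProperty (FGModuleCat.{u} A)} (hW : IsWideMem W)
include hW

/-- A wide subcategory containing a left approximation of the regular module contains a
reflection of it. -/
lemma exists_reflection [IsArtinianRing A] {L : FGModuleCat.{u} A} (g : A →ₗ[A] L) (hL : Mem W L)
    (h : ∀ (N : Type u) [AddCommGroup N] [Module A N], Mem W N → ∀ f : A →ₗ[A] N,
        ∃ f' : L →ₗ[A] N, f' ∘ₗ g = f) :
    ∃ (R : FGModuleCat.{u} A) (r : R), Mem W R ∧
      ∀ (N : Type u) [AddCommGroup N] [Module A N], Mem W N → ∀ n : N,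
        ∃! f : R →ₗ[A] N, f r = n := by
  obtain ⟨P, ⟨hP, hgP⟩, hmin⟩ := IsArtinian.set_has_minimal
    {P : Submodule A L | Mem W P ∧ g 1 ∈ P}
    ⟨⊤, hL.of_equiv Submodule.topEquiv.symm, trivial⟩
  refine ⟨FGModuleCat.of A P, ⟨g 1, hgP⟩, hP, fun N _ _ hN n => ?_⟩
  refine existsUnique_of_exists_of_unique ?_ ?_
  · obtain ⟨f, hf⟩ := h N hN (LinearMap.toSpanSingleton A N n)
    refine ⟨f ∘ₗ P.subtype, ?_⟩
    simpa using LinearMap.congr_fun hf 1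
  · intro f₁ f₂ h₁ h₂
    -- The locus where two candidates agree lies in `W` and contains `g 1`, so by minimality it is
    -- all of `P`.
    let Q := (LinearMap.ker (f₁ - f₂)).map P.subtype
    have hQ : Mem W Q := (hW.ker _ _ (f₁ - f₂) hP hN).of_equiv
      (Submodule.equivMapOfInjective _ P.subtype_injective _)
    have hgQ : g 1 ∈ Q := ⟨⟨g 1, hgP⟩, by
      change f₁ ⟨g 1, hgP⟩ - f₂ ⟨g 1, hgP⟩ = 0
      rw [h₁, h₂, sub_self], rfl⟩
    have hle : Q ≤ P := Submodule.map_subtype_le _ _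
    have hQP : Q = P := by
      by_contra hne
      exact hmin Q ⟨hQ, hgQ⟩ (hle.lt_of_ne hne)
    ext ⟨x, hx⟩
    have hx' := hx
    rw [← hQP] at hx'
    obtain ⟨z, hz, rfl⟩ := hx'
    exact sub_eq_zero.1 hz

/-- Given a reflection `R` of the regular module and a module `X` all of whose maps from `R`
factor through `p : R ^ n ⟶ X`, a quotient of `R ^ n` is a right approximation of `X`. -/
lemma exists_right {R : Type u} [AddCommGroup R] [Module A R] (r : R) (hR : Mem W R)
    (hr : ∀ (N : Type u) [AddCommGroup N] [Module A N], Mem W N → ∀ n : N,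
        ∃! f : R →ₗ[A] N, f r = n)
    {X : Type u} [AddCommGroup X] [Module A X] {n : ℕ} (p : (Fin n → R) →ₗ[A] X)
    (hp : ∀ φ : R →ₗ[A] X, ∃ ψ : R →ₗ[A] (Fin n → R), p ∘ₗ ψ = φ) :
    ∃ (L : FGModuleCat.{u} A) (g : L →ₗ[A] X), Mem W L ∧
      ∀ (N : Type u) [AddCommGroup N] [Module A N], Mem W N → ∀ f : N →ₗ[A] X,
        ∃ f' : N →ₗ[A] L, g ∘ₗ f' = f := by
  have hE := hW.isExtensionClosed
  have hRn : Mem W (Fin n → R) := hE.pi _ fun _ => hR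
  have := hRn.finite
  obtain ⟨U, ⟨hUp, hU⟩, hmax⟩ := set_has_maximal_iff_noetherian.2
    (inferInstance : IsNoetherian A (Fin n → R))
    {P : Submodule A (Fin n → R) | P ≤ LinearMap.ker p ∧ Mem W P}
    ⟨⊥, bot_le, hE.of_subsingleton⟩
  have hUmax : ∀ P : Submodule A (Fin n → R), P ≤ LinearMap.ker p → Mem W P → P ≤ U := by
    intro P hPp hP
    by_contra hPU
    refine hmax (U ⊔ P) ⟨sup_le hUp hPp, ?_⟩ (left_lt_sup.2 hPU)
    have h := hW.range (U.subtype.coprod P.subtype) (hE.prod hU hP) hRn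
    rwa [LinearMap.range_coprod, Submodule.range_subtype, Submodule.range_subtype] at h
  have hL := hW.quotient hU hRn
  -- By the universal property `ψ` lifts to `R ^ n`; the lift has its image in `ker p` and in `W`,
  -- hence in `U`.
  have hinj : ∀ ψ : R →ₗ[A] ((Fin n → R) ⧸ U), U.liftQ p hUp ∘ₗ ψ = 0 → ψ = 0 := by
    intro ψ hψ
    obtain ⟨y, hy⟩ := U.mkQ_surjective (ψ r)
    obtain ⟨ψ', hψ', -⟩ := hr _ hRn y
    have hψψ' : ψ = U.mkQ ∘ₗ ψ' := (hr _ hL (ψ r)).unique rfl (by simp [hψ', ← hy])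
    subst hψψ'
    have := hUmax (LinearMap.range ψ') (LinearMap.range_le_ker_iff.2 hψ) (hW.range _ hR hRn)
    ext x
    exact (Submodule.Quotient.mk_eq_zero U).2 (this ⟨x, rfl⟩)
  refine ⟨FGModuleCat.of A ((Fin n → R) ⧸ U), U.liftQ p hUp, hL, fun N _ _ hN f => ?_⟩
  have := hN.finite
  obtain ⟨k, q, hq⟩ := exists_surjective_pi (M := N) r fun m => (hr N hN m).exists
  choose ψ hψ using fun i => hp (f ∘ₗ q ∘ₗ LinearMap.single A (fun _ : Fin k => R) i)
  -- `F` lifts `f ∘ₗ q`, coordinate by coordinate. The scalars `ℕ` serve because `A` need not be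
  -- commutative.
  let F : (Fin k → R) →ₗ[A] ((Fin n → R) ⧸ U) :=
    LinearMap.lsum A (fun _ : Fin k => R) ℕ fun i => U.mkQ ∘ₗ ψ i
  have hF : U.liftQ p hUp ∘ₗ F = f ∘ₗ q := by
    refine LinearMap.pi_ext' fun i => ?_
    rw [LinearMap.comp_assoc, LinearMap.comp_assoc, ← hψ i]
    ext x
    exact congr_arg (U.liftQ p hUp)
      (LinearMap.lsum_piSingle A (fun _ : Fin k => R) ℕ (fun i => U.mkQ ∘ₗ ψ i) i x)
  -- The kernel of `q` lies in `W`, so each of its elements is the value at `r` of a map from `R`,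
  -- and `hinj` applies to the composite with `F`.
  have hker : LinearMap.ker q ≤ LinearMap.ker F := by
    intro x hx
    have hk := hW.ker _ _ q (hE.pi _ fun _ => hR) hN
    obtain ⟨h, hh, -⟩ := hr _ hk ⟨x, hx⟩
    have h0 := hinj (F ∘ₗ (LinearMap.ker q).subtype ∘ₗ h) (by
      rw [← LinearMap.comp_assoc, hF]
      ext y
      have : q (h y) = 0 := (h y).2
      simp [this])
    have := LinearMap.congr_fun h0 r
    simpa [hh] using this
  refine ⟨(LinearMap.ker q).liftQ F hker ∘ₗ (q.quotKerEquivOfSurjective hq).symm.toLinearMap, ?_⟩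
  ext m
  obtain ⟨x, rfl⟩ := hq m
  have : (q.quotKerEquivOfSurjective hq).symm (q x) = (LinearMap.ker q).mkQ x := by
    rw [LinearEquiv.symm_apply_eq]
    rfl
  have hFx := LinearMap.congr_fun hF x
  simpa [this] using hFx

end IsWideMem

end Approximations

/-! ### Finite-dimensional Hom spaces and functorial finiteness -/

section FiniteDimensional

variable (K : Type v) [Field K] [Algebra K A] [FiniteDimensional K A]

lemma exists_pi_factor_of_isScalarTower (M N : Type u) [AddCommGroup M] [Module A M] [Module K M]
    [IsScalarTower K A M] [Module.Finite A M] [AddCommGroup N] [Module A N] [Module K N]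
    [IsScalarTower K A N] [Module.Finite A N] :
    ∃ (n : ℕ) (p : (Fin n → M) →ₗ[A] N),
      ∀ φ : M →ₗ[A] N, ∃ ψ : M →ₗ[A] (Fin n → M), p ∘ₗ ψ = φ := by
  have : Module.Finite K M := Module.Finite.trans A M
  have : Module.Finite K N := Module.Finite.trans A N
  have : SMulCommClass A K N := IsScalarTower.to_smulCommClass'
  have : SMulCommClass A K M := IsScalarTower.to_smulCommClass'
  have : Module.Finite K (M →ₗ[A] N) :=
    Module.Finite.of_injective (LinearMap.restrictScalarsₗ K A M N K)
      (LinearMap.restrictScalars_injective K)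
  obtain ⟨n, q, hq⟩ := Module.Finite.exists_fin' K (M →ₗ[A] N)
  -- The components of `p` span `M →ₗ[A] N` over `K`; the coordinates of `ψ` are the coefficients of
  -- `φ` times the identity.
  refine ⟨n, ∑ i, q (fun j => if i = j then 1 else 0) ∘ₗ LinearMap.proj i, fun φ => ?_⟩
  obtain ⟨c, rfl⟩ := hq φ
  refine ⟨LinearMap.pi fun i => c i • LinearMap.id, ?_⟩
  rw [LinearMap.pi_apply_eq_sum_univ q c]
  ext x
  simp only [LinearMap.comp_apply, LinearMap.sum_apply, LinearMap.proj_apply, LinearMap.pi_apply,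
    LinearMap.smul_apply, LinearMap.id_apply]
  refine Finset.sum_congr rfl fun i _ => ?_
  exact LinearMap.map_smul_of_tower _ _ _

include K in
/-- All maps between two finitely generated modules factor through a single map out of a power of
the source. -/
lemma exists_pi_factor (M N : Type u) [AddCommGroup M] [Module A M] [Module.Finite A M]
    [AddCommGroup N] [Module A N] [Module.Finite A N] :
    ∃ (n : ℕ) (p : (Fin n → M) →ₗ[A] N),
      ∀ φ : M →ₗ[A] N, ∃ ψ : M →ₗ[A] (Fin n → M), p ∘ₗ ψ = φ := by
  let _ := Module.compHom M (algebraMap K A)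
  let _ := Module.compHom N (algebraMap K A)
  have : IsScalarTower K A M := ⟨fun k a m => by
    rw [Algebra.smul_def, mul_smul]; rfl⟩
  have : IsScalarTower K A N := ⟨fun k a m => by
    rw [Algebra.smul_def, mul_smul]; rfl⟩
  exact exists_pi_factor_of_isScalarTower K M N

include K in
theorem IsTorsionClass.isFunctoriallyFinite_alpha {T : ObjectProperty (FGModuleCat.{u} A)}
    [IsNoetherianRing A] [IsArtinianRing A]
    (hT : IsTorsionClass T) (hff : IsFunctoriallyFinite T) : IsFunctoriallyFinite (alpha T) := by
  have hα := hT.isWideMem_alpha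
  have := hα.replete
  obtain ⟨L, g, hL, h⟩ := hT.exists_left_alpha hff A
  obtain ⟨R, r, hR, hr⟩ := hα.exists_reflection g hL h
  refine isFunctoriallyFinite_of (fun M => ?_) fun M => ?_
  · obtain ⟨L, g, hL, h⟩ := hT.exists_left_alpha hff M
    exact ⟨L, g, mem_iff.1 hL, fun N hN f => h N (mem_of_prop hN) f⟩
  · obtain ⟨n, p, hp⟩ := exists_pi_factor (A := A) K R M
    obtain ⟨L, g, hL, h⟩ := hα.exists_right r hR hr p hp
    exact ⟨L, g, mem_iff.1 hL, fun N hN f => h N (mem_of_prop hN) f⟩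

end FiniteDimensional

end ModSubcat

theorem theorem3p8 {K : Type v} {A : Type u} [Field K] [IsAlgClosed K] [Ring A] [Algebra K A]
    [FiniteDimensional K A] :
    Set.BijOn ModSubcat.alpha
      {T : ObjectProperty (FGModuleCat.{u} A) |
        ModSubcat.IsTorsionClass T ∧ ModSubcat.IsFunctoriallyFinite T}
      {W : ObjectProperty (FGModuleCat.{u} A) |
        ModSubcat.IsWide W ∧ ModSubcat.IsFunctoriallyFinite W ∧
          ModSubcat.IsFunctoriallyFinite (ModSubcat.filt (ModSubcat.gen W))} := by
  have : IsNoetherianRing A := isNoetherian_of_tower K inferInstance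
  have : IsArtinianRing A := isArtinian_of_tower K inferInstance
  refine ⟨?_, ?_, ?_⟩
  · rintro T ⟨hT, hff⟩
    refine ⟨hT.isWideMem_alpha.isWide, hT.isFunctoriallyFinite_alpha K hff, ?_⟩
    rwa [hT.filt_gen_alpha hff]
  · rintro T ⟨hT, hff⟩ T' ⟨hT', hff'⟩ h
    rw [← hT.filt_gen_alpha hff, h, hT'.filt_gen_alpha hff']
  · rintro W ⟨hW, -, hff⟩
    exact ⟨ModSubcat.filt (ModSubcat.gen W), ⟨ModSubcat.isTorsionClass_filt_gen W, hff⟩,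
      hW.isWideMem.alpha_filt_gen⟩
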